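/- A \emph{stochastic decision problem} $\mathcal D=(A,X_1,\dots,X_n,U,P)$ consists of a finite set $A$ of actions, finite coordinate sets $X_1,\dots,X_n$, a utility function $U:A\times S\to\mathbb Q$ and a rational-valued probability distribution $P$ on the state space $S=X_1\times\dots\times X_n$. Put $\mathrm{Opt}(s)=\arg\max_{a\in A}U(a,s)$ for $s\in S$. For $I\subseteq\{1,\dots,n\}$ let $s_I$ be the restriction of $s$ to $I$, and for a value $\alpha$ of $S_I$ with $P(S_I=\alpha)>0$ put \[\mathrm{Opt}^{\mathrm{stoch}}_I(\alpha)=\arg\max_{a\in A}\mathbb E[U(a,S)\mid S_I=\alpha],\qquad S\sim P.\] The set $I$ is \emph{stochastically sufficient} if $\mathrm{Opt}^{\mathrm{stoch}}_I(s_I)=\mathrm{Opt}(s)$ for every $s\in S$. At states $s$ with $P(S_I=s_I)=0$ this equality is read by any one of the following conventions, fixed once and for all: (a) it is not required; (b) it counts as false; (c) all actions count as conditionally optimal, that is, $\mathrm{Opt}^{\mathrm{stoch}}_I(s_I)=A$. \textsc{Stochastic-Minimum-Preservation}: given $\mathcal D$ and $k\in\mathbb N$, is there a stochastically sufficient set $I$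 with $|I|\le k$? \textsc{Stochastic-Anchor-Preservation}: given $\mathcal D$ and $I\subseteq\{1,\dots,n\}$, is there a state $s_0\in S$ such that $\mathrm{Opt}^{\mathrm{stoch}}_I(s_I)=\mathrm{Opt}(s)$ for every $s\in S$ with $s_I=(s_0)_I$ (with the same convention on fibers of probability zero)? In the explicit-state encoding an instance is written as a word that gives $|A|$, the sizes $|X_i|$, and the complete table of all states $s\in S$ with their coordinates, the probability $P(s)$ and the utilities $U(a,s)$ for all $a\in A$; all numbers are in binary, rational numbers as fractions in lowest terms. The budget $k$ is appended in binary, respectively the set $I$ as a 0/1 sequence of length $n$. \textbf{Theorem.} Under the explicit-state encoding, and under each of the conventions (a), (b), (c), \textsc{Stochastic-Minimum-Preservation} and \textsc{Stochastic-Anchor-Preservation} are both decidable in polynomial time: for each there is a Turing machine that decides every encoded instance in a number of steps bounded by a polynomial in the length of the input word. -/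

import Mathlib

/-! ## Stochastic decision problems -/

/-- A stochastic decision problem with action set `A` and state space `S = ∏ i, X i`: a utility
`U : A → S → ℚ` and a probability distribution `P` on `S`. The values are rational so that an
instance can be written down as a finite word. -/
structure StochasticDecisionProblem (A : Type) {ι : Type} [Fintype ι] [DecidableEq ι]
    (X : ι → Type) [∀ i, Fintype (X i)] where
  util : A → (∀ i, X i) → ℚ
  prob : (∀ i, X i) → ℚ
  prob_nonneg : ∀ s, 0 ≤ prob s
  prob_sum : ∑ s, prob s = 1

/-- What `Opt_I(s_I) = Opt(s)` means at a state `s` with `P(S_I = s_I) = 0`, where the conditional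
expectation given `S_I = s_I` is undefined. -/
inductive NullFiberConvention where
  /-- The requirement is imposed only at states in fibers of positive probability. -/
  | exempt : NullFiberConvention
  /-- The requirement fails at states in fibers of probability zero. -/
  | strict : NullFiberConvention
  /-- On a fiber of probability zero all conditional expected utilities count as `0`, so that all
  actions are conditionally optimal. -/
  | tie : NullFiberConvention

namespace StochasticDecisionProblem

variable {A : Type} {ι : Type} [Fintype ι] [DecidableEq ι] {X : ι → Type} [∀ i, Fintype (X i)]
  [∀ i, DecidableEq (X i)]

/-- The full-information optimizer `Opt(s) = argmax_a U(a, s)`. -/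
def opt (D : StochasticDecisionProblem A X) (s : ∀ i, X i) : Set A :=
  {a | ∀ b, D.util b s ≤ D.util a s}

/-- The fiber `{s : s_I = α}`. -/
def fiber (I : Finset ι) (α : ∀ i : I, X i) : Finset (∀ i, X i) :=
  Finset.univ.filter fun s => I.restrict s = α

/-- `P(S_I = α)`. -/
def fiberProb (D : StochasticDecisionProblem A X) (I : Finset ι) (α : ∀ i : I, X i) : ℚ :=
  ∑ s ∈ fiber I α, D.prob s

/-- `E[U(a, S) | S_I = α]`, for `P(S_I = α) > 0`; the quotient is `0` if `P(S_I = α) = 0`. -/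
def condUtil (D : StochasticDecisionProblem A X) (I : Finset ι) (α : ∀ i : I, X i) (a : A) : ℚ :=
  (∑ s ∈ fiber I α, D.prob s * D.util a s) / D.fiberProb I α

/-- The conditional optimizer `Opt_I(α) = argmax_a E[U(a, S) | S_I = α]`. -/
def condOpt (D : StochasticDecisionProblem A X) (I : Finset ι) (α : ∀ i : I, X i) : Set A :=
  {a | ∀ b, D.condUtil I α b ≤ D.condUtil I α a}

/-- `Opt_I(s_I) = Opt(s)`, read on fibers of probability zero according to `c`. -/
def PreservedAt (D : StochasticDecisionProblem A X) (c : NullFiberConvention) (I : Finset ι)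
    (s : ∀ i, X i) : Prop :=
  match c with
  | .exempt => 0 < D.fiberProb I (I.restrict s) → D.condOpt I (I.restrict s) = D.opt s
  | .strict => 0 < D.fiberProb I (I.restrict s) ∧ D.condOpt I (I.restrict s) = D.opt s
  | .tie => D.condOpt I (I.restrict s) = D.opt s

/-- The coordinate set `I` is stochastically sufficient. -/
def StochasticallySufficient (D : StochasticDecisionProblem A X) (c : NullFiberConvention)
    (I : Finset ι) : Prop :=
  ∀ s, D.PreservedAt c I s

/-- The question of Stochastic-Minimum-Preservation. -/
def MinimumPreservation (D : StochasticDecisionProblem A X) (c : NullFiberConvention)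
    (k : ℕ) : Prop :=
  ∃ I : Finset ι, I.card ≤ k ∧ D.StochasticallySufficient c I

/-- The question of Stochastic-Anchor-Preservation. -/
def AnchorPreservation (D : StochasticDecisionProblem A X) (c : NullFiberConvention)
    (I : Finset ι) : Prop :=
  ∃ s₀ : ∀ i, X i, ∀ s : ∀ i, X i, (∀ i ∈ I, s i = s₀ i) → D.PreservedAt c I s

end StochasticDecisionProblem

/-! ## The explicit-state encoding -/

/-- An instance with coordinates `0, …, numCoords - 1`, where `X i = {0, …, numValues i - 1}`,
and actions `0, …, numActions - 1`. -/
structure ExplicitInstance where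
  numCoords : ℕ
  numValues : Fin numCoords → ℕ
  numActions : ℕ
  problem : StochasticDecisionProblem (Fin numActions) (fun i => Fin (numValues i))

namespace ExplicitInstance

open Computability

/-- The word for a natural number: its binary digits, followed by a comma. -/
def encodeNumeral (k : ℕ) : List Γ' :=
  (encodeNat k).map Γ'.bit ++ [Γ'.comma]

/-- The word for a rational number in lowest terms: a sign bit, the absolute value of the
numerator, and the denominator, both in binary. -/
def encodeRational (q : ℚ) : List Γ' :=
  Γ'.bit (decide (q < 0)) :: (encodeNumeral q.num.natAbs ++ encodeNumeral q.den)

/-- The word for a finite sequence: the words for its members, between brackets. -/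
def encodeSeq {α : Type} (enc : α → List Γ') (l : List α) : List Γ' :=
  Γ'.bra :: (l.flatMap enc ++ [Γ'.ket])

/-- A list of all states, each exactly once. -/
def states (D : ExplicitInstance) : List (∀ i, Fin (D.numValues i)) :=
  (List.finRange (∏ i, D.numValues i)).map finPiFinEquiv.symm

/-- The table entry for the state `s`: its coordinates, its probability `P(s)`, and the utilities
`U(a, s)` of all actions. -/
def encodeRow (D : ExplicitInstance) (s : ∀ i, Fin (D.numValues i)) : List Γ' :=
  encodeSeq (fun i => encodeNumeral (s i)) (List.finRange D.numCoords) ++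
    encodeRational (D.problem.prob s) ++
    encodeSeq (fun a => encodeRational (D.problem.util a s)) (List.finRange D.numActions)

/-- The word for an instance: the number of actions, the sizes of all `X i`, and the full table of
all states with their probabilities and utilities. -/
def encode (D : ExplicitInstance) : List Γ' :=
  encodeNumeral D.numActions ++
    encodeSeq (fun i => encodeNumeral (D.numValues i)) (List.finRange D.numCoords) ++
    encodeSeq D.encodeRow D.states

/-- An instance together with a budget `k`, written in binary. -/
def encodeWithBudget (x : ExplicitInstance × ℕ) : List Γ' :=
  x.1.encode ++ encodeNumeral x.2

/-- An instance together with a coordinate set `I`, written as its indicator sequence. -/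
def encodeWithCoords (x : Σ D : ExplicitInstance, Finset (Fin D.numCoords)) : List Γ' :=
  x.1.encode ++ encodeSeq (fun i => [Γ'.bit (decide (i ∈ x.2))]) (List.finRange x.1.numCoords)

end ExplicitInstance

/-! ## Polynomial-time decidability -/

/-- The decision problem `p` on the inputs `α`, given as words through `enc`, is decided by a
(multi-stack) Turing machine whose number of steps is bounded by a polynomial in the length of the
input word. -/
def PolyTimeDecidable {α Γ : Type} (enc : α → List Γ) (p : α → Prop) : Prop :=
  ∃ f : α → Bool, (∀ x, f x = true ↔ p x) ∧
    Nonempty (Turing.TM2ComputableInPolyTime enc Computability.encodeBool f)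

/-! Mathematically, the full table is so long that brute force is polynomial. A fiber is a set of
rows, and its probability and the sums of P(s) U(a, s) over it are sums over rows. Comparing
conditional expectations amounts to comparing these sums: the common denominator is positive, and if
it vanishes then every summand vanishes too (`condUtil_le_iff`). So preservation at one state can be
checked directly under each convention. For anchors, every state of the table is tried. For minimum
preservation there are 2 ^ n candidate sets, possibly far more than states, but coordinates with a
single value never change a fiber (`preservedAt_congr`) and can be removed. If m coordinates have at
least two values, then 2 ^ m ≤ |S|; the remaining candidates are exactly the sets of nonzero
coordinates of states, so a search over rows finds them all (`minimum_iff`).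

Arithmetic uses unreduced fractions. Adding a summand whose entries have at most k bits lengthens
the entries by at most k + 1 bits, so long sums stay polynomial (`Fraction.Bounded.foldl_add`).

For the machine model, structured stack programs are compiled to Turing machines with the same step
count (`Eval.steps_eq`). All data are binary trees in prefix code. The class `PolyTime` of tree
functions computed in polynomial time is closed under composition, pairing, branching and folds with
polynomially bounded accumulator, and the decision procedures are built from these closure
properties. A one-pass parser turns the input word into a tree (`parseFrom_encode`), and
`PolyTime.polyTimeDecidable` adds the reading of the input and the writing of the answer. -/

/-! ## A structured language for machines with several stacks -/

namespace StackProgram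

open Turing Computability

/-- The stacks: input, output, a main stack, two auxiliary stacks and a counter. -/
inductive Stk
  | inp | out | main | left | right | cnt
  deriving DecidableEq

instance : Fintype Stk where
  elems := {.inp, .out, .main, .left, .right, .cnt}
  complete k := by cases k <;> decide

/-- The stack alphabets. -/
abbrev Sym : Stk → Type
  | .inp => Γ'
  | .out => Bool
  | .main => Bool
  | .left => Option Bool
  | .right => Option Bool
  | .cnt => Unit

/-- The contents of all stacks. -/
abbrev Store := ∀ k, List (Sym k)

/-- Structured programs. Tests look at the top of one stack. -/
inductive Cmd
  | skip : Cmd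
  | push (k : Stk) (a : Sym k) : Cmd
  | pop (k : Stk) : Cmd
  | seq (c d : Cmd) : Cmd
  | ite (k : Stk) (p : Option (Sym k) → Bool) (c d : Cmd) : Cmd
  | loop (k : Stk) (p : Option (Sym k) → Bool) (c : Cmd) : Cmd

namespace Cmd

/-- `Eval c S t S'`: the program `c` takes `S` to `S'` in `t` steps. -/
inductive Eval : Cmd → Store → ℕ → Store → Prop
  | skip (S) : Eval skip S 1 S
  | push (k a S) : Eval (push k a) S 1 (Function.update S k (a :: S k))
  | pop (k S) : Eval (pop k) S 1 (Function.update S k (S k).tail)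
  | seq {c d S t S' u S''} : Eval c S t S' → Eval d S' u S'' → Eval (seq c d) S (t + u) S''
  | ite_true {k p c d S t S'} : p (S k).head? = true → Eval c S t S' →
      Eval (ite k p c d) S (1 + t) S'
  | ite_false {k p c d S t S'} : p (S k).head? = false → Eval d S t S' →
      Eval (ite k p c d) S (1 + t) S'
  | loop_done {k p c S} : p (S k).head? = false → Eval (loop k p c) S 1 S
  | loop_step {k p c S t S' u S''} : p (S k).head? = true → Eval c S t S' →
      Eval (loop k p c) S' u S'' → Eval (loop k p c) S (1 + (t + u)) S''

/-- The control positions of a program. -/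
def Pos : Cmd → Type
  | skip => Unit
  | push _ _ => Unit
  | pop _ => Unit
  | seq c d => Pos c ⊕ Pos d
  | ite _ _ c d => Option (Pos c ⊕ Pos d)
  | loop _ _ c => Option (Pos c)

instance fintypePos : ∀ c, Fintype (Pos c)
  | skip => inferInstanceAs (Fintype Unit)
  | push _ _ => inferInstanceAs (Fintype Unit)
  | pop _ => inferInstanceAs (Fintype Unit)
  | seq c d => haveI := fintypePos c; haveI := fintypePos d; inferInstanceAs (Fintype (_ ⊕ _))
  | ite _ _ c d =>
    haveI := fintypePos c; haveI := fintypePos d; inferInstanceAs (Fintype (Option (_ ⊕ _)))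
  | loop _ _ c => haveI := fintypePos c; inferInstanceAs (Fintype (Option _))

/-- The position at which execution starts. -/
def entry : ∀ c, Pos c
  | skip => ()
  | push _ _ => ()
  | pop _ => ()
  | seq c _ => Sum.inl (entry c)
  | ite _ _ _ _ => none
  | loop _ _ _ => none

/-- A jump to `l₁` or `l₂` according to the top of the stack `k`. -/
def jump {Λ : Type} (k : Stk) (p : Option (Sym k) → Bool) (l₁ l₂ : Λ) : TM2.Stmt Sym Λ Bool :=
  .peek k (fun _ s => p s) (.goto fun v => bif v then l₁ else l₂)

/-- The machine code of a program, placed at the labels `emb` and leaving to the label `exit`. -/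
def code {Λ : Type} : ∀ c, (Pos c → Λ) → Λ → Pos c → TM2.Stmt Sym Λ Bool
  | skip, _, exit, _ => .goto fun _ => exit
  | push k a, _, exit, _ => .push k (fun _ => a) (.goto fun _ => exit)
  | pop k, _, exit, _ => .pop k (fun v _ => v) (.goto fun _ => exit)
  | seq c d, emb, _, Sum.inl p => code c (emb ∘ Sum.inl) (emb (Sum.inr (entry d))) p
  | seq _ d, emb, exit, Sum.inr p => code d (emb ∘ Sum.inr) exit p
  | ite k p c d, emb, _, none =>
    jump k p (emb (some (Sum.inl (entry c)))) (emb (some (Sum.inr (entry d))))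
  | ite _ _ c _, emb, exit, some (Sum.inl q) => code c (emb ∘ some ∘ Sum.inl) exit q
  | ite _ _ _ d, emb, exit, some (Sum.inr q) => code d (emb ∘ some ∘ Sum.inr) exit q
  | loop k p c, emb, exit, none => jump k p (emb (some (entry c))) exit
  | loop _ _ c, emb, _, some q => code c (emb ∘ some) (emb none) q

/-- `t` steps of a machine. -/
abbrev steps {Λ : Type} (M : Λ → TM2.Stmt Sym Λ Bool) (t : ℕ) :
    Option (TM2.Cfg Sym Λ Bool) → Option (TM2.Cfg Sym Λ Bool) :=
  (flip bind (TM2.step M))^[t]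

theorem steps_add {Λ : Type} (M : Λ → TM2.Stmt Sym Λ Bool) (t u : ℕ) (x) :
    steps M (t + u) x = steps M u (steps M t x) := by
  rw [steps, add_comm, Function.iterate_add_apply]

theorem steps_jump {Λ : Type} (M : Λ → TM2.Stmt Sym Λ Bool) {l : Λ} {k p} {l₁ l₂ : Λ}
    (h : M l = jump k p l₁ l₂) (v : Bool) (S : Store) :
    steps M 1 (some ⟨some l, v, S⟩) =
      some ⟨some (bif p (S k).head? then l₁ else l₂), p (S k).head?, S⟩ := by
  simp [steps, flip, h, jump]

/-- The host machine, the embedding of positions and the exit label are arbitrary, so that the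
induction hypotheses apply to subprograms placed inside a larger program. The register may start
with any value, since every test overwrites it before it is read. -/
theorem Eval.steps_eq {c S t S'} (h : Eval c S t S') :
    ∀ {Λ : Type} (M : Λ → TM2.Stmt Sym Λ Bool) (emb : Pos c → Λ) (exit : Λ),
      (∀ p, M (emb p) = code c emb exit p) → ∀ v, ∃ v',
        steps M t (some ⟨some (emb (entry c)), v, S⟩) = some ⟨some exit, v', S'⟩ := by
  induction h with
  | skip S =>
    intro Λ M emb exit hM v
    exact ⟨v, by simp [steps, flip, hM, code]⟩
  | push k a S =>
    intro Λ M emb exit hM v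
    exact ⟨v, by simp [steps, flip, hM, code]⟩
  | pop k S =>
    intro Λ M emb exit hM v
    exact ⟨v, by simp [steps, flip, hM, code]⟩
  | @seq c d S t S' u S'' _ _ ihc ihd =>
    intro Λ M emb exit hM v
    obtain ⟨v', hv'⟩ := ihc M (emb ∘ Sum.inl) (emb (Sum.inr (entry d))) (fun p => hM (.inl p)) v
    obtain ⟨v'', hv''⟩ := ihd M (emb ∘ Sum.inr) exit (fun p => hM (.inr p)) v'
    refine ⟨v'', ?_⟩
    rw [steps_add]
    exact (congrArg _ hv').trans hv''
  | @ite_true k p c d S t S' hp _ ih =>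
    intro Λ M emb exit hM v
    obtain ⟨v', hv'⟩ := ih M (emb ∘ some ∘ Sum.inl) exit (fun p => hM (some (.inl p)))
      (p (S k).head?)
    refine ⟨v', ?_⟩
    rw [steps_add]
    exact (congrArg _ ((steps_jump M (hM none) v S).trans (by rw [hp]; rfl))).trans hv'
  | @ite_false k p c d S t S' hp _ ih =>
    intro Λ M emb exit hM v
    obtain ⟨v', hv'⟩ := ih M (emb ∘ some ∘ Sum.inr) exit (fun p => hM (some (.inr p)))
      (p (S k).head?)
    refine ⟨v', ?_⟩
    rw [steps_add]
    exact (congrArg _ ((steps_jump M (hM none) v S).trans (by rw [hp]; rfl))).trans hv'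
  | @loop_done k p c S hp =>
    intro Λ M emb exit hM v
    exact ⟨_, by rw [entry, steps_jump M (hM none), hp]; rfl⟩
  | @loop_step k p c S t S' u S'' hp _ _ ihc ihl =>
    intro Λ M emb exit hM v
    obtain ⟨v', hv'⟩ := ihc M (emb ∘ some) (emb none) (fun p => hM (some p)) (p (S k).head?)
    obtain ⟨v'', hv''⟩ := ihl M emb exit hM v'
    refine ⟨v'', ?_⟩
    rw [steps_add, steps_add]
    refine (congrArg _ (congrArg _ ?_)).trans ((congrArg _ hv').trans hv'')
    exact (steps_jump M (hM none) v S).trans (by rw [hp]; rfl)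

/-- The program `c` takes `S` to `S'` in at most `t` steps. -/
def Runs (c : Cmd) (S : Store) (t : ℕ) (S' : Store) : Prop :=
  ∃ u ≤ t, Eval c S u S'

theorem Runs.mono {c S t u S'} (h : Runs c S t S') (htu : t ≤ u) : Runs c S u S' :=
  let ⟨v, hv, e⟩ := h
  ⟨v, hv.trans htu, e⟩

theorem Runs.seq {c d S t S' u S''} (h : Runs c S t S') (h' : Runs d S' u S'') :
    Runs (seq c d) S (t + u) S'' :=
  let ⟨_, hv, e⟩ := h
  let ⟨_, hv', e'⟩ := h'
  ⟨_, add_le_add hv hv', e.seq e'⟩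

theorem Runs.ite_true {k p c d S t S'} (hp : p (S k).head? = true) (h : Runs c S t S') :
    Runs (ite k p c d) S (1 + t) S' :=
  let ⟨_, hv, e⟩ := h
  ⟨_, Nat.add_le_add_left hv 1, .ite_true hp e⟩

theorem Runs.ite_false {k p c d S t S'} (hp : p (S k).head? = false) (h : Runs d S t S') :
    Runs (ite k p c d) S (1 + t) S' :=
  let ⟨_, hv, e⟩ := h
  ⟨_, Nat.add_le_add_left hv 1, .ite_false hp e⟩

theorem Runs.loop_done {k p c S} (hp : p (S k).head? = false) : Runs (loop k p c) S 1 S :=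
  ⟨1, le_rfl, .loop_done hp⟩

theorem Runs.loop_step {k p c S t S' u S''} (hp : p (S k).head? = true) (h : Runs c S t S')
    (h' : Runs (loop k p c) S' u S'') : Runs (loop k p c) S (1 + (t + u)) S'' :=
  let ⟨_, hv, e⟩ := h
  let ⟨_, hv', e'⟩ := h'
  ⟨_, Nat.add_le_add_left (add_le_add hv hv') 1, .loop_step hp e e'⟩

theorem Runs.skip (S : Store) : Runs .skip S 1 S := ⟨1, le_rfl, .skip S⟩

theorem Runs.push {S S' : Store} (k a) (h : Function.update S k (a :: S k) = S') :
    Runs (.push k a) S 1 S' := ⟨1, le_rfl, h ▸ .push k a S⟩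

theorem Runs.pop {S S' : Store} (k) (h : Function.update S k (S k).tail = S') :
    Runs (.pop k) S 1 S' := ⟨1, le_rfl, h ▸ .pop k S⟩

end Cmd

/-- A store, stack by stack. -/
def store (i : List Γ') (o m : List Bool) (a b : List (Option Bool)) (n : List Unit) : Store
  | .inp => i
  | .out => o
  | .main => m
  | .left => a
  | .right => b
  | .cnt => n

section store

open Cmd

variable (i : List Γ') (o m : List Bool) (a b : List (Option Bool)) (n : List Unit)

@[simp] theorem store_inp : store i o m a b n .inp = i := rfl

/-- The primitives are restated on explicit stores, so that runs can be chained by unification. -/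
theorem runs_push_out (s : Bool) :
    Runs (.push .out s) (store i o m a b n) 1 (store i (s :: o) m a b n) :=
  Runs.push _ _ (by funext k; cases k <;> rfl)

theorem runs_push_main (s : Bool) :
    Runs (.push .main s) (store i o m a b n) 1 (store i o (s :: m) a b n) :=
  Runs.push _ _ (by funext k; cases k <;> rfl)

theorem runs_push_left (s : Option Bool) :
    Runs (.push .left s) (store i o m a b n) 1 (store i o m (s :: a) b n) :=
  Runs.push _ _ (by funext k; cases k <;> rfl)

theorem runs_push_right (s : Option Bool) :
    Runs (.push .right s) (store i o m a b n) 1 (store i o m a (s :: b) n) :=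
  Runs.push _ _ (by funext k; cases k <;> rfl)

theorem runs_push_cnt (s : Unit) :
    Runs (.push .cnt s) (store i o m a b n) 1 (store i o m a b (s :: n)) :=
  Runs.push _ _ (by funext k; cases k <;> rfl)

theorem runs_pop_inp (s : Γ') :
    Runs (.pop .inp) (store (s :: i) o m a b n) 1 (store i o m a b n) :=
  Runs.pop _ (by funext k; cases k <;> rfl)

theorem runs_pop_main (s : Bool) :
    Runs (.pop .main) (store i o (s :: m) a b n) 1 (store i o m a b n) :=
  Runs.pop _ (by funext k; cases k <;> rfl)

theorem runs_pop_left (s : Option Bool) :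
    Runs (.pop .left) (store i o m (s :: a) b n) 1 (store i o m a b n) :=
  Runs.pop _ (by funext k; cases k <;> rfl)

theorem runs_pop_right (s : Option Bool) :
    Runs (.pop .right) (store i o m a (s :: b) n) 1 (store i o m a b n) :=
  Runs.pop _ (by funext k; cases k <;> rfl)

theorem runs_pop_cnt (s : Unit) :
    Runs (.pop .cnt) (store i o m a b (s :: n)) 1 (store i o m a b n) :=
  Runs.pop _ (by funext k; cases k <;> rfl)

end store

end StackProgram

/-! ## Binary trees on the main stack -/

/-- Binary trees, the universal data type of the programs. -/
inductive DTree
  | leaf : DTree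
  | node (x y : DTree) : DTree

namespace DTree

/-- The prefix code of a tree. -/
def code : DTree → List Bool
  | leaf => [false]
  | node x y => true :: (x.code ++ y.code)

/-- The number of vertices of a tree. -/
def size : DTree → ℕ
  | leaf => 1
  | node x y => 1 + x.size + y.size

@[simp] theorem length_code : ∀ x : DTree, x.code.length = x.size
  | leaf => rfl
  | node x y => by simp [code, size, length_code x, length_code y]; omega

theorem code_node_append (x y : DTree) (r : List Bool) :
    (node x y).code ++ r = true :: (x.code ++ (y.code ++ r)) := by simp [code]

theorem size_pos (x : DTree) : 0 < x.size := by cases x <;> simp [size]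

/-- The left subtree; a leaf for a leaf. -/
def fst : DTree → DTree
  | leaf => leaf
  | node x _ => x

/-- The right subtree; a leaf for a leaf. -/
def snd : DTree → DTree
  | leaf => leaf
  | node _ y => y

/-- Whether a tree has a root with two children. -/
def isNode : DTree → Bool
  | leaf => false
  | node _ _ => true

end DTree

/-! ### Moving, copying and taking apart trees on the stacks -/

namespace StackProgram

open Turing Computability Cmd

/-- The stores between two operations: the tree data lie on the main stack, and only the auxiliary
stacks may hold other data. -/
abbrev work (m : List Bool) (a b : List (Option Bool)) : Store := store [] [] m a b []

/-- Push a symbol on the selected auxiliary stacks. -/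
def emit (fa fb : Bool) (s : Bool) : Cmd :=
  .seq (bif fa then .push .left (some s) else .skip) (bif fb then .push .right (some s) else .skip)

/-- The loop of `walk`. -/
def walkLoop (fa fb : Bool) : Cmd :=
  .loop .cnt Option.isSome <|
    .ite .main (fun s => s == some true)
      (.seq (.pop .main) (.seq (emit fa fb true) (.push .cnt ())))
      (.seq (.pop .main) (.seq (emit fa fb false) (.pop .cnt)))

/-- Remove a tree from the main stack and reverse its code onto the selected auxiliary stacks. -/
def walk (fa fb : Bool) : Cmd := .seq (.push .cnt ()) (walkLoop fa fb)

/-- The effect of `walk` on an auxiliary stack. -/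
def ext (f : Bool) (w : List Bool) (a : List (Option Bool)) : List (Option Bool) :=
  bif f then (w.map some).reverse ++ a else a

theorem ext_append (f : Bool) (w w' : List Bool) (a) :
    ext f (w ++ w') a = ext f w' (ext f w a) := by
  cases f <;> simp [ext]

theorem runs_emit (fa fb s : Bool) (i o m a b n) :
    Runs (emit fa fb s) (store i o m a b n) 2 (store i o m (ext fa [s] a) (ext fb [s] b) n) := by
  refine (?_ : Runs _ _ 1 (store i o m (ext fa [s] a) b n)).seq (?_ : Runs _ _ 1 _)
  · cases fa
    · exact Runs.skip _
    · exact runs_push_left ..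
  · cases fb
    · exact Runs.skip _
    · exact runs_push_right ..

/-- The counter holds the number of subtrees still to be read: `true` replaces one pending tree by
two, `false` completes one. The form with a continuation, extending a later run backwards, lets the
induction treat the two children one after the other. Each symbol costs six steps. -/
theorem runs_walkLoop (fa fb : Bool) (x : DTree) : ∀ {i o r a b n t S'},
    Runs (walkLoop fa fb) (store i o r (ext fa x.code a) (ext fb x.code b) n) t S' →
      Runs (walkLoop fa fb) (store i o (x.code ++ r) a b (() :: n)) (t + 6 * x.size) S' := by
  induction x with
  | leaf =>
    intro i o r a b n t S' h
    refine (Runs.loop_step rfl (Runs.ite_false rfl ((runs_pop_main i o r ..).seq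
      ((runs_emit fa fb false ..).seq (runs_pop_cnt ..)))) h).mono ?_
    simp only [DTree.size]; omega
  | node x y ihx ihy =>
    intro i o r a b n t S' h
    have e : ∀ f c, ext f (DTree.node x y).code c = ext f y.code (ext f x.code (ext f [true] c)) := by
      intro f c
      rw [← ext_append, ← ext_append]; simp [DTree.code]
    rw [e, e] at h
    have h' := ihx (ihy h)
    rw [← List.append_assoc] at h'
    refine (Runs.loop_step rfl (Runs.ite_true rfl ((runs_pop_main i o (x.code ++ y.code ++ r) ..).seq
      ((runs_emit fa fb true ..).seq (runs_push_cnt ..)))) h').mono ?_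
    simp only [DTree.size]; omega

theorem runs_walk (fa fb : Bool) (x : DTree) (r a b) :
    Runs (walk fa fb) (work (x.code ++ r) a b) (2 + 6 * x.size)
      (work r (ext fa x.code a) (ext fb x.code b)) := by
  refine ((runs_push_cnt ..).seq
    (runs_walkLoop fa fb x (Runs.loop_done rfl))).mono ?_
  omega

/-- The loop of `restoreLeft`. -/
def restoreLeftLoop : Cmd :=
  .loop .left (fun s => s != some none) <|
    .ite .left (fun s => s == some (some true))
      (.seq (.pop .left) (.push .main true)) (.seq (.pop .left) (.push .main false))

/-- Move a word from the left auxiliary stack back to the main stack. -/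
def restoreLeft : Cmd := .seq restoreLeftLoop (.pop .left)

/-- Popping undoes the reversal caused by saving; the marker `none` separates the word from older
contents of the stack and stops the loop. -/
theorem runs_restoreLeftLoop (v r : List Bool) (a b) :
    Runs restoreLeftLoop (work r (v.map some ++ none :: a) b) (1 + 4 * v.length)
      (work (v.reverse ++ r) (none :: a) b) := by
  induction v generalizing r with
  | nil => exact Runs.loop_done rfl
  | cons s v ih =>
    have h := ih (s :: r)
    rw [show v.reverse ++ s :: r = (s :: v).reverse ++ r by simp] at h
    cases s
    · refine (Runs.loop_step rfl (Runs.ite_false rfl ((runs_pop_left ..).seq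
        (runs_push_main ..))) h).mono ?_
      rw [List.length_cons]; omega
    · refine (Runs.loop_step rfl (Runs.ite_true rfl ((runs_pop_left ..).seq
        (runs_push_main ..))) h).mono ?_
      rw [List.length_cons]; omega

theorem runs_restoreLeft (w r : List Bool) (a b) :
    Runs restoreLeft (work r ((w.map some).reverse ++ none :: a) b) (2 + 4 * w.length)
      (work (w ++ r) a b) := by
  have h := runs_restoreLeftLoop w.reverse r a b
  rw [List.map_reverse, List.reverse_reverse, List.length_reverse] at h
  exact (h.seq (runs_pop_left ..)).mono (by omega)

/-- The loop of `restoreRight`. -/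
def restoreRightLoop : Cmd :=
  .loop .right (fun s => s != some none) <|
    .ite .right (fun s => s == some (some true))
      (.seq (.pop .right) (.push .main true)) (.seq (.pop .right) (.push .main false))

/-- Move a word from the right auxiliary stack back to the main stack. -/
def restoreRight : Cmd := .seq restoreRightLoop (.pop .right)

theorem runs_restoreRightLoop (v r : List Bool) (a b) :
    Runs restoreRightLoop (work r a (v.map some ++ none :: b)) (1 + 4 * v.length)
      (work (v.reverse ++ r) a (none :: b)) := by
  induction v generalizing r with
  | nil => exact Runs.loop_done rfl
  | cons s v ih =>
    have h := ih (s :: r)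
    rw [show v.reverse ++ s :: r = (s :: v).reverse ++ r by simp] at h
    cases s
    · refine (Runs.loop_step rfl (Runs.ite_false rfl ((runs_pop_right ..).seq
        (runs_push_main ..))) h).mono ?_
      rw [List.length_cons]; omega
    · refine (Runs.loop_step rfl (Runs.ite_true rfl ((runs_pop_right ..).seq
        (runs_push_main ..))) h).mono ?_
      rw [List.length_cons]; omega

theorem runs_restoreRight (w r : List Bool) (a b) :
    Runs restoreRight (work r a ((w.map some).reverse ++ none :: b)) (2 + 4 * w.length)
      (work (w ++ r) a b) := by
  have h := runs_restoreRightLoop w.reverse r a b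
  rw [List.map_reverse, List.reverse_reverse, List.length_reverse] at h
  exact (h.seq (runs_pop_right ..)).mono (by omega)

/-- Move the top tree of the main stack to the left auxiliary stack. -/
def saveLeft : Cmd := .seq (.push .left none) (walk true false)

/-- Move the top tree of the main stack to the right auxiliary stack. -/
def saveRight : Cmd := .seq (.push .right none) (walk false true)

theorem runs_saveLeft (x : DTree) (r a b) :
    Runs saveLeft (work (x.code ++ r) a b) (3 + 6 * x.size)
      (work r ((x.code.map some).reverse ++ none :: a) b) :=
  ((runs_push_left ..).seq (runs_walk true false x r (none :: a) b)).mono (by omega)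

theorem runs_saveRight (x : DTree) (r a b) :
    Runs saveRight (work (x.code ++ r) a b) (3 + 6 * x.size)
      (work r a ((x.code.map some).reverse ++ none :: b)) :=
  ((runs_push_right ..).seq (runs_walk false true x r a (none :: b))).mono (by omega)

/-- Remove the top tree. -/
def drop : Cmd := walk false false

theorem runs_drop (x : DTree) (r a b) :
    Runs drop (work (x.code ++ r) a b) (2 + 6 * x.size) (work r a b) :=
  runs_walk false false x r a b

/-- Duplicate the top tree. -/
def dup : Cmd :=
  .seq (.push .left none) (.seq (.push .right none) (.seq (walk true true)
    (.seq restoreLeft restoreRight)))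

theorem runs_dup (x : DTree) (r a b) :
    Runs dup (work (x.code ++ r) a b) (8 + 14 * x.size) (work (x.code ++ (x.code ++ r)) a b) := by
  refine ((runs_push_left ..).seq ((runs_push_right ..).seq
    ((runs_walk true true x r (none :: a) (none :: b)).seq ((runs_restoreLeft x.code _ _ _).seq
      (runs_restoreRight x.code _ _ _))))).mono ?_
  rw [DTree.length_code]; omega

/-- Exchange the two top trees. -/
def swap : Cmd := .seq saveLeft (.seq saveRight (.seq restoreLeft restoreRight))

theorem runs_swap (x y : DTree) (r a b) :
    Runs swap (work (x.code ++ (y.code ++ r)) a b) (10 + 10 * (x.size + y.size))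
      (work (y.code ++ (x.code ++ r)) a b) := by
  refine ((runs_saveLeft x _ _ _).seq ((runs_saveRight y _ _ _).seq
    ((runs_restoreLeft _ _ _ _).seq (runs_restoreRight _ _ _ _)))).mono ?_
  simp only [DTree.length_code]; omega

/-- Push a word on the main stack. -/
def pushWord : List Bool → Cmd
  | [] => .skip
  | s :: w => .seq (pushWord w) (.push .main s)

theorem runs_pushWord (w : List Bool) (i o m a b n) :
    Runs (pushWord w) (store i o m a b n) (1 + w.length) (store i o (w ++ m) a b n) := by
  induction w with
  | nil => exact Runs.skip _
  | cons s w ih => exact (ih.seq (runs_push_main ..)).mono (by rw [List.length_cons]; omega)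

/-- Replace the top tree by its left subtree. -/
def takeFst : Cmd :=
  .ite .main (fun s => s == some true)
    (.seq (.pop .main) (.seq saveLeft (.seq drop restoreLeft))) .skip

/-- Without its leading `true`, the code of a node is the code of the left subtree followed by that
of the right one. A leaf is left alone, in accordance with the default value of `fst`. -/
theorem runs_takeFst (x : DTree) (r a b) :
    Runs takeFst (work (x.code ++ r) a b) (9 + 10 * x.size) (work (x.fst.code ++ r) a b) := by
  cases x with
  | leaf => exact (Runs.ite_false rfl (Runs.skip _)).mono (by omega)
  | node x y =>
    rw [DTree.code_node_append]
    refine (Runs.ite_true rfl ((runs_pop_main ..).seq ((runs_saveLeft x _ _ _).seq ((runs_drop y _ _ _).seq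
        (runs_restoreLeft _ _ _ _))))).mono ?_
    simp only [DTree.length_code, DTree.size]; omega

/-- Replace the top tree by its right subtree. -/
def takeSnd : Cmd :=
  .ite .main (fun s => s == some true) (.seq (.pop .main) drop) .skip

theorem runs_takeSnd (x : DTree) (r a b) :
    Runs takeSnd (work (x.code ++ r) a b) (9 + 10 * x.size) (work (x.snd.code ++ r) a b) := by
  cases x with
  | leaf => exact (Runs.ite_false rfl (Runs.skip _)).mono (by omega)
  | node x y =>
    rw [DTree.code_node_append]
    refine (Runs.ite_true rfl ((runs_pop_main ..).seq (runs_drop x _ _ _))).mono ?_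
    simp only [DTree.size]; omega

end StackProgram

/-! ## Polynomial-time functions on data encoded as trees -/

open StackProgram StackProgram.Cmd

/-- Types whose members are written as trees. -/
class TreeEnc (α : Type) where
  /-- The tree of a member. -/
  enc : α → DTree

open TreeEnc

/-- The size of the tree of `x`. -/
def treeSize {α : Type} [TreeEnc α] (x : α) : ℕ := (enc x).size

section instances

variable {α β : Type} [TreeEnc α] [TreeEnc β]

instance : TreeEnc DTree := ⟨id⟩

instance : TreeEnc Unit := ⟨fun _ => .leaf⟩

instance : TreeEnc Bool := ⟨fun b => bif b then .node .leaf .leaf else .leaf⟩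

instance : TreeEnc (α × β) := ⟨fun x => .node (enc x.1) (enc x.2)⟩

/-- The tree of a list is a comb. -/
def encList : List α → DTree
  | [] => .leaf
  | a :: l => .node (enc a) (encList l)

instance : TreeEnc (List α) := ⟨encList⟩

@[simp] theorem enc_tree (x : DTree) : enc x = x := rfl
@[simp] theorem enc_pair (a : α) (b : β) : enc (a, b) = .node (enc a) (enc b) := rfl
@[simp] theorem enc_nil : enc ([] : List α) = .leaf := rfl
@[simp] theorem enc_cons (a : α) (l : List α) : enc (a :: l) = .node (enc a) (enc l) := rfl
@[simp] theorem enc_true : enc true = .node .leaf .leaf := rfl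
@[simp] theorem enc_false : enc false = .leaf := rfl

@[simp] theorem treeSize_pair (a : α) (b : β) :
    treeSize (a, b) = 1 + treeSize a + treeSize b := rfl
@[simp] theorem treeSize_nil : treeSize ([] : List α) = 1 := rfl
@[simp] theorem treeSize_cons (a : α) (l : List α) :
    treeSize (a :: l) = 1 + treeSize a + treeSize l := rfl
theorem treeSize_bool (b : Bool) : treeSize b ≤ 3 := by cases b <;> decide

theorem treeSize_pos (a : α) : 0 < treeSize a := DTree.size_pos _

theorem treeSize_le_of_mem {a : α} {l : List α} (h : a ∈ l) : treeSize a ≤ treeSize l := by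
  induction l with
  | nil => simp at h
  | cons b l ih =>
    rw [treeSize_cons]
    rcases List.mem_cons.1 h with rfl | h
    · omega
    · have := ih h; omega

theorem length_le_treeSize (l : List α) : l.length ≤ treeSize l := by
  induction l with
  | nil => simp
  | cons b l ih => rw [treeSize_cons, List.length_cons]; omega

theorem treeSize_le_of_prefix {l l' : List α} (h : l' <+: l) : treeSize l' ≤ treeSize l := by
  obtain ⟨m, rfl⟩ := h
  induction l' with
  | nil => exact DTree.size_pos _
  | cons b l ih => simp only [List.cons_append, treeSize_cons]; omega

end instances

theorem Polynomial.eval_nat_mono (p : Polynomial ℕ) {m n : ℕ} (h : m ≤ n) :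
    p.eval m ≤ p.eval n := by
  rw [Polynomial.eval_eq_sum, Polynomial.eval_eq_sum]
  exact Finset.sum_le_sum fun i _ => Nat.mul_le_mul_left _ (Nat.pow_le_pow_left h i)

/-- A function computed by a program in time polynomial in the size of the argument. -/
def PolyTime {α β : Type} [TreeEnc α] [TreeEnc β] (f : α → β) : Prop :=
  ∃ (c : Cmd) (p : Polynomial ℕ), ∀ x, treeSize (f x) ≤ p.eval (treeSize x) ∧
    ∀ r a b, Runs c (work ((enc x).code ++ r) a b) (p.eval (treeSize x))
      (work ((enc (f x)).code ++ r) a b)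

namespace PolyTime

variable {α β γ δ σ : Type} [TreeEnc α] [TreeEnc β] [TreeEnc γ] [TreeEnc δ] [TreeEnc σ]

open Polynomial in
theorem of_runs {f : α → β} (c : Cmd) (p q : Polynomial ℕ)
    (hs : ∀ x, treeSize (f x) ≤ q.eval (treeSize x))
    (hr : ∀ x r a b, Runs c (work ((enc x).code ++ r) a b) (p.eval (treeSize x))
      (work ((enc (f x)).code ++ r) a b)) : PolyTime f :=
  ⟨c, p + q, fun x => ⟨by rw [eval_add]; exact (hs x).trans (Nat.le_add_left _ _),
    fun r a b => (hr x r a b).mono (by rw [eval_add]; exact Nat.le_add_right _ _)⟩⟩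

/-- The size of the value is polynomially bounded. -/
theorem size_le {f : α → β} (hf : PolyTime f) :
    ∃ p : Polynomial ℕ, ∀ x, treeSize (f x) ≤ p.eval (treeSize x) :=
  let ⟨_, p, h⟩ := hf
  ⟨p, fun x => (h x).1⟩

/-- `PolyTime` sees a value only through its tree, so passing between a value and its tree is
definitional. Through `congr_enc` data can thus change their type at no cost. -/
theorem of_enc {f : α → β} (hf : PolyTime fun x => enc (f x)) : PolyTime f := hf

theorem enc_of {f : α → β} (hf : PolyTime f) : PolyTime fun x => enc (f x) := hf

theorem congr {f g : α → β} (hf : PolyTime f) (h : ∀ x, f x = g x) : PolyTime g :=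
  (funext h : f = g) ▸ hf

theorem congr_enc {f : α → β} {g : α → γ} (hf : PolyTime f) (h : ∀ x, enc (f x) = enc (g x)) :
    PolyTime g :=
  of_enc (hf.enc_of.congr h)

theorem id : PolyTime fun x : α => x :=
  of_runs .skip 1 Polynomial.X (fun x => by simp) fun x r a b => by simpa using Runs.skip _

theorem enc : PolyTime fun x : α => TreeEnc.enc x := (id : PolyTime fun x : α => x).enc_of

/-- This is where the size bound in `PolyTime` is needed: the second program runs on a value of
polynomial size, and polynomials over ℕ are monotone. -/
theorem comp {g : β → γ} {f : α → β} (hg : PolyTime g) (hf : PolyTime f) :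
    PolyTime fun x => g (f x) := by
  obtain ⟨c, p, hp⟩ := hf
  obtain ⟨d, q, hq⟩ := hg
  refine of_runs (.seq c d) (p + q.comp p) (q.comp p) (fun x => ?_) fun x r a b => ?_
  · rw [Polynomial.eval_comp]
    exact ((hq _).1).trans (q.eval_nat_mono (hp x).1)
  · refine (((hp x).2 r a b).seq ((hq _).2 r a b)).mono ?_
    rw [Polynomial.eval_add, Polynomial.eval_comp]
    exact Nat.add_le_add_left (q.eval_nat_mono (hp x).1) _

theorem const (b : β) : PolyTime fun _ : α => b := by
  refine of_runs (.seq drop (pushWord (TreeEnc.enc b).code))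
    (3 + Polynomial.C (treeSize b) + 6 * Polynomial.X)
    (Polynomial.C (treeSize b)) (fun x => by simp) fun x r a b' => ?_
  refine ((runs_drop _ r a b').seq (runs_pushWord _ ..)).mono ?_
  simp [treeSize]; omega

theorem pair {f : α → β} {g : α → γ} (hf : PolyTime f) (hg : PolyTime g) :
    PolyTime fun x => (f x, g x) := by
  obtain ⟨c, p, hp⟩ := hf
  obtain ⟨d, q, hq⟩ := hg
  -- Each program works on its own copy of the argument; a final `true` in front of the two results
  -- makes them the code of a pair.
  refine of_runs (.seq dup (.seq d (.seq swap (.seq c (.push .main true)))))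
    (20 + 24 * Polynomial.X + 11 * q + p) (1 + p + q) (fun x => ?_) fun x r a b => ?_
  · have := (hp x).1; have := (hq x).1
    simp only [treeSize_pair, Polynomial.eval_add, Polynomial.eval_one]; omega
  · have h := (runs_dup (TreeEnc.enc x) r a b).seq <| ((hq x).2 _ a b).seq <|
      (runs_swap _ _ r a b).seq <| ((hp x).2 _ a b).seq <|
        runs_push_main (s := true) ..
    rw [show (TreeEnc.enc (f x, g x)).code ++ r = _ from DTree.code_node_append ..]
    refine h.mono ?_
    have := (hq x).1
    simp only [treeSize, Polynomial.eval_add, Polynomial.eval_mul, Polynomial.eval_ofNat,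
      Polynomial.eval_X] at *
    omega

theorem treeFst : PolyTime DTree.fst :=
  of_runs takeFst (9 + 10 * Polynomial.X) Polynomial.X
    (fun x => by cases x <;> simp [treeSize, DTree.fst, DTree.size]; omega)
    fun x r a b => by simpa [treeSize] using runs_takeFst x r a b

theorem treeSnd : PolyTime DTree.snd :=
  of_runs takeSnd (9 + 10 * Polynomial.X) Polynomial.X
    (fun x => by cases x <;> simp [treeSize, DTree.snd, DTree.size])
    fun x r a b => by simpa [treeSize] using runs_takeSnd x r a b

theorem treeIsNode : PolyTime DTree.isNode := by
  refine of_runs (.ite .main (fun s => s == some true)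
    (.seq drop (pushWord (TreeEnc.enc true).code)) .skip) (7 + 6 * Polynomial.X) 3
    (fun x => by simpa using treeSize_bool _) fun x r a b => ?_
  cases x with
  | leaf => exact (Runs.ite_false rfl (Runs.skip _)).mono (by simp; omega)
  | node x y =>
    refine (Runs.ite_true rfl ((runs_drop (.node x y) r a b).seq (runs_pushWord _ ..))).mono ?_
    simp [treeSize, DTree.size]; omega

theorem bcond {t : α → Bool} {f g : α → β} (ht : PolyTime t) (hf : PolyTime f)
    (hg : PolyTime g) : PolyTime fun x => bif t x then f x else g x := by
  obtain ⟨e, s, hs⟩ := ht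
  obtain ⟨c, p, hp⟩ := hf
  obtain ⟨d, q, hq⟩ := hg
  -- The code of `true` has three symbols and that of `false` has one, hence three pops in one
  -- branch and one in the other.
  refine of_runs (.seq dup (.seq e (.ite .main (fun s => s == some true)
    (.seq (.pop .main) (.seq (.pop .main) (.seq (.pop .main) c))) (.seq (.pop .main) d))))
    (12 + 14 * Polynomial.X + s + p + q) (p + q) (fun x => ?_) fun x r a b => ?_
  · have := (hp x).1; have := (hq x).1
    rw [Polynomial.eval_add]
    cases t x <;> simp only [cond_true, cond_false] <;> omega
  · have h := (hs x).2 ((TreeEnc.enc x).code ++ r) a b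
    simp only [Polynomial.eval_add, Polynomial.eval_mul, Polynomial.eval_ofNat, Polynomial.eval_X]
    cases ht : t x
    · rw [ht] at h
      refine ((runs_dup _ r a b).seq (h.seq (Runs.ite_false rfl ((runs_pop_main ..).seq
        ((hq x).2 r a b))))).mono ?_
      simp only [treeSize]; omega
    · rw [ht] at h
      refine ((runs_dup _ r a b).seq (h.seq (Runs.ite_true rfl ((runs_pop_main ..).seq
        ((runs_pop_main ..).seq ((runs_pop_main ..).seq ((hp x).2 r a b))))))).mono ?_
      simp only [treeSize]; omega

/-- The loop that folds a program over the list on top of the stack, with the accumulator below. -/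
def foldLoop (c : Cmd) : Cmd :=
  .loop .main (fun s => s == some true) <|
    .seq (.pop .main) <| .seq saveLeft <| .seq saveRight <| .seq restoreLeft <|
      .seq (.push .main true) <| .seq c restoreRight

/-- In each round the head of the list goes to the left stack and the tail to the right one; the
head returns on top of the accumulator, a `true` makes them a pair for `c`, and the tail is
restored. The intermediate accumulators are the folds over prefixes, so `N` and `B` bound the cost
of every round uniformly. The final `false` is the code of the exhausted list. -/
theorem runs_foldLoop {f : α × β → β} {c : Cmd} {p : Polynomial ℕ}
    (hp : ∀ x, treeSize (f x) ≤ p.eval (treeSize x) ∧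
      ∀ r a b, Runs c (work ((TreeEnc.enc x).code ++ r) a b) (p.eval (treeSize x))
        (work ((TreeEnc.enc (f x)).code ++ r) a b)) (N B : ℕ) (r a b) (l : List α) :
    ∀ y : β, treeSize l ≤ N →
      (∀ l', l' <+: l → treeSize (l'.foldl (fun y x => f (x, y)) y) ≤ B) →
      Runs (foldLoop c) (work ((TreeEnc.enc l).code ++ ((TreeEnc.enc y).code ++ r)) a b)
        (1 + l.length * (13 + 10 * N + p.eval (1 + N + B)))
        (work (false :: ((TreeEnc.enc (l.foldl (fun y x => f (x, y)) y)).code ++ r)) a b) := by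
  induction l with
  | nil => exact fun y _ _ => (Runs.loop_done rfl).mono (by simp)
  | cons x l ih =>
    intro y hN hB
    rw [treeSize_cons] at hN
    have h := ih (f (x, y)) (by omega) fun l' hl' => by
      simpa using hB (x :: l') (List.cons_prefix_cons.2 ⟨rfl, hl'⟩)
    rw [enc_cons, DTree.code_node_append]
    have h1 := (hp (x, y)).2 r a (((TreeEnc.enc l).code.map some).reverse ++ none :: b)
    rw [enc_pair, DTree.code_node_append] at h1
    refine (Runs.loop_step rfl ((runs_pop_main ..).seq <| (runs_saveLeft _ ..).seq <|
      (runs_saveRight _ ..).seq <| (runs_restoreLeft _ ..).seq <| (runs_push_main ..).seq <|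
      h1.seq <| runs_restoreRight _ ..) h).mono ?_
    have hy : treeSize y ≤ B := by simpa using hB [] List.nil_prefix
    have h2 : p.eval (treeSize (x, y)) ≤ p.eval (1 + N + B) :=
      p.eval_nat_mono (by rw [treeSize_pair]; omega)
    simp only [DTree.length_code, List.length_cons, Nat.add_mul]
    simp only [treeSize] at *
    omega

theorem foldl_uncurried {f : α × β → β} {G : σ → List α × β} (hf : PolyTime f) (hG : PolyTime G)
    (q : Polynomial ℕ) (hq : ∀ s l', l' <+: (G s).1 →
      treeSize (l'.foldl (fun y x => f (x, y)) (G s).2) ≤ q.eval (treeSize s)) :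
    PolyTime fun s => (G s).1.foldl (fun y x => f (x, y)) (G s).2 := by
  obtain ⟨c, p, hp⟩ := hf
  obtain ⟨d, g, hg⟩ := hG
  -- The two pops remove the root of the pair and the empty list that the loop leaves behind.
  refine of_runs (.seq d (.seq (.pop .main) (.seq (foldLoop c) (.pop .main))))
    (3 + g + g * (13 + 10 * g + p.comp (1 + g + q))) q (fun s => hq s _ List.prefix_rfl)
    fun s r a b => ?_
  have h := (hg s).2 r a b
  have hN := (hg s).1
  rw [show (TreeEnc.enc (G s)).code ++ r = _ from DTree.code_node_append ..] at h
  have hs : treeSize (G s) = 1 + treeSize (G s).1 + treeSize (G s).2 := rfl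
  have hl := length_le_treeSize (G s).1
  refine (h.seq ((runs_pop_main ..).seq ((runs_foldLoop hp (g.eval (treeSize s))
    (q.eval (treeSize s)) r a b (G s).1 (G s).2 (by omega) (hq s)).seq (runs_pop_main ..)))).mono ?_
  simp only [Polynomial.eval_add, Polynomial.eval_mul, Polynomial.eval_ofNat,
    Polynomial.eval_comp, Polynomial.eval_one]
  have := Nat.mul_le_mul_right (13 + 10 * g.eval (treeSize s) +
    p.eval (1 + g.eval (treeSize s) + q.eval (treeSize s))) (show (G s).1.length ≤ _ by
      exact hl.trans (show _ ≤ g.eval (treeSize s) by omega))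
  omega

end PolyTime

open TreeEnc

namespace PolyTime

variable {α β γ δ σ : Type} [TreeEnc α] [TreeEnc β] [TreeEnc γ] [TreeEnc δ] [TreeEnc σ]

/-! ### Pairs and Booleans -/

theorem fst' : PolyTime fun x : α × β => x.1 :=
  of_enc ((treeFst.comp enc).congr fun _ => rfl)

theorem snd' : PolyTime fun x : α × β => x.2 :=
  of_enc ((treeSnd.comp enc).congr fun _ => rfl)

theorem fst {f : α → β × γ} (hf : PolyTime f) : PolyTime fun x => (f x).1 := fst'.comp hf

theorem snd {f : α → β × γ} (hf : PolyTime f) : PolyTime fun x => (f x).2 := snd'.comp hf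

theorem not {f : α → Bool} (hf : PolyTime f) : PolyTime fun x => !f x :=
  (bcond hf (const false) (const true)).congr fun x => by cases f x <;> rfl

theorem and {f g : α → Bool} (hf : PolyTime f) (hg : PolyTime g) : PolyTime fun x => f x && g x :=
  (bcond hf hg (const false)).congr fun x => by cases f x <;> rfl

theorem or {f g : α → Bool} (hf : PolyTime f) (hg : PolyTime g) : PolyTime fun x => f x || g x :=
  (bcond hf (const true) hg).congr fun x => by cases f x <;> rfl

theorem beq {f g : α → Bool} (hf : PolyTime f) (hg : PolyTime g) :
    PolyTime fun x => f x == g x :=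
  (bcond hf hg hg.not).congr fun x => by cases f x <;> cases g x <;> rfl

/-! ### Lists -/

theorem cons {f : α → β} {l : α → List β} (hf : PolyTime f) (hl : PolyTime l) :
    PolyTime fun x => f x :: l x :=
  (hf.pair hl).congr_enc fun _ => rfl

theorem isEmpty {l : α → List β} (hl : PolyTime l) : PolyTime fun x => (l x).isEmpty :=
  (treeIsNode.comp hl.enc_of).not.congr fun x => by cases l x <;> rfl

theorem headD {l : α → List β} {d : α → β} (hl : PolyTime l) (hd : PolyTime d) :
    PolyTime fun x => (l x).headD (d x) :=
  of_enc ((bcond hl.isEmpty hd.enc_of (treeFst.comp hl.enc_of)).congr fun x => by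
    cases l x <;> rfl)

theorem tail {l : α → List β} (hl : PolyTime l) : PolyTime fun x => (l x).tail :=
  of_enc ((treeSnd.comp hl.enc_of).congr fun x => by cases l x <;> rfl)

/-- Folding a list, if the accumulator stays polynomially bounded. -/
theorem foldl {l : σ → List α} {init : σ → β} {f : σ → β → α → β} (hl : PolyTime l)
    (hi : PolyTime init) (hf : PolyTime fun x : σ × β × α => f x.1 x.2.1 x.2.2)
    (hq : ∃ q : Polynomial ℕ, ∀ s l', l' <+: l s →
      treeSize (l'.foldl (f s) (init s)) ≤ q.eval (treeSize s)) :
    PolyTime fun s => (l s).foldl (f s) (init s) := by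
  obtain ⟨q, hq⟩ := hq
  -- The loop body sees only the element and the accumulator, so the parameter `s` travels inside
  -- the accumulator.
  have key : ∀ s (l' : List α) y, l'.foldl (fun (y : σ × β) x => (y.1, f y.1 y.2 x)) (s, y) =
      (s, l'.foldl (f s) y) := by
    intro s l'
    induction l' with
    | nil => exact fun y => rfl
    | cons x l' ih => exact fun y => ih _
  have hf' : PolyTime fun x : α × σ × β => (x.2.1, f x.2.1 x.2.2 x.1) :=
    snd'.fst.pair (hf.comp (snd'.fst.pair (snd'.snd.pair fst')))
  have h := foldl_uncurried (G := fun s => (l s, s, init s)) hf' (hl.pair (id.pair hi))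
    (1 + Polynomial.X + q) fun s l' hl' => by
      simp only [key, treeSize_pair, Polynomial.eval_add, Polynomial.eval_one, Polynomial.eval_X]
      exact Nat.add_le_add_left (hq s l' hl') _
  exact h.snd.congr fun s => by simp only [key]

/-- Folding a list, if every step adds a polynomially bounded amount to the accumulator. -/
theorem foldl_of_growth {l : σ → List α} {init : σ → β} {f : σ → β → α → β} (hl : PolyTime l)
    (hi : PolyTime init) (hf : PolyTime fun x : σ × β × α => f x.1 x.2.1 x.2.2)
    (hk : ∃ k : Polynomial ℕ, ∀ s y x,
      treeSize (f s y x) ≤ treeSize y + k.eval (treeSize (s, x))) :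
    PolyTime fun s => (l s).foldl (f s) (init s) := by
  obtain ⟨k, hk⟩ := hk
  obtain ⟨p, hp⟩ := hl.size_le
  obtain ⟨q, hq⟩ := hi.size_le
  refine foldl hl hi hf ⟨q + p * k.comp (1 + Polynomial.X + p), fun s l' hl' => ?_⟩
  have hmem : ∀ x ∈ l', treeSize x ≤ p.eval (treeSize s) := fun x hx =>
    (treeSize_le_of_mem (hl'.subset hx)).trans (hp s)
  have hlen : l'.length ≤ p.eval (treeSize s) :=
    (length_le_treeSize l').trans ((treeSize_le_of_prefix hl').trans (hp s))
  have key : ∀ (l' : List α) y, (∀ x ∈ l', treeSize x ≤ p.eval (treeSize s)) →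
      treeSize (l'.foldl (f s) y) ≤ treeSize y +
        l'.length * k.eval (1 + treeSize s + p.eval (treeSize s)) := by
    intro l'
    induction l' with
    | nil => exact fun y _ => by simp
    | cons x l' ih =>
      intro y hx
      have h1 := ih (f s y x) fun z hz => hx z (List.mem_cons_of_mem _ hz)
      have h2 := hk s y x
      have h3 := k.eval_nat_mono (show treeSize (s, x) ≤ 1 + treeSize s + p.eval (treeSize s) by
        rw [treeSize_pair]; exact Nat.add_le_add_left (hx x List.mem_cons_self) _)
      rw [List.foldl_cons, List.length_cons, Nat.add_mul]
      omega
  refine (key l' (init s) hmem).trans ?_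
  simp only [Polynomial.eval_add, Polynomial.eval_mul, Polynomial.eval_comp, Polynomial.eval_one,
    Polynomial.eval_X]
  exact Nat.add_le_add (hq s) (Nat.mul_le_mul_right _ hlen)

theorem reverse {l : σ → List α} (hl : PolyTime l) : PolyTime fun s => (l s).reverse :=
  (foldl_of_growth (f := fun _ m x => x :: m) hl (const []) (snd'.snd.cons snd'.fst)
    ⟨Polynomial.X, fun s y x => by
      simp only [treeSize_cons, treeSize_pair, Polynomial.eval_X]; omega⟩).congr fun s => by simp

theorem append {l m : σ → List α} (hl : PolyTime l) (hm : PolyTime m) :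
    PolyTime fun s => l s ++ m s :=
  (foldl_of_growth (f := fun _ m x => x :: m) hl.reverse hm (snd'.snd.cons snd'.fst)
    ⟨Polynomial.X, fun s y x => by
      simp only [treeSize_cons, treeSize_pair, Polynomial.eval_X]; omega⟩).congr fun s => by simp

theorem map {l : σ → List α} {f : σ → α → β} (hl : PolyTime l)
    (hf : PolyTime fun x : σ × α => f x.1 x.2) : PolyTime fun s => (l s).map (f s) := by
  obtain ⟨p, hp⟩ := hf.size_le
  refine (foldl_of_growth (f := fun s m x => f s x :: m) hl (const [])
    ((hf.comp (fst'.pair snd'.snd)).cons snd'.fst)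
    ⟨1 + p, fun s y x => ?_⟩).reverse.congr fun s => by simp
  have := hp (s, x)
  simp only [treeSize_cons, Polynomial.eval_add, Polynomial.eval_one] at *
  omega

theorem filter {l : σ → List α} {t : σ → α → Bool} (hl : PolyTime l)
    (ht : PolyTime fun x : σ × α => t x.1 x.2) : PolyTime fun s => (l s).filter (t s) := by
  refine (foldl_of_growth (f := fun s m x => bif t s x then x :: m else m) hl (const [])
    (bcond (ht.comp (fst'.pair snd'.snd)) (snd'.snd.cons snd'.fst) snd'.fst)
    ⟨Polynomial.X, fun s y x => ?_⟩).reverse.congr fun s => ?_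
  · simp only [treeSize_pair, Polynomial.eval_X]
    cases t s x <;> simp only [cond_true, cond_false, treeSize_cons] <;> omega
  · have key : ∀ (l' m : List α), (l'.foldl (fun m x => bif t s x then x :: m else m) m).reverse =
        m.reverse ++ l'.filter (t s) := by
      intro l'
      induction l' with
      | nil => simp
      | cons x l' ih => intro m; cases h : t s x <;> simp [ih, h]
    simpa using key (l s) []

theorem all {l : σ → List α} {t : σ → α → Bool} (hl : PolyTime l)
    (ht : PolyTime fun x : σ × α => t x.1 x.2) : PolyTime fun s => (l s).all (t s) :=
  (hl.filter (t := fun s a => !t s a) ht.not).isEmpty.congr fun s => by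
    rw [Bool.eq_iff_iff]; simp [List.isEmpty_iff, List.filter_eq_nil_iff]

theorem any {l : σ → List α} {t : σ → α → Bool} (hl : PolyTime l)
    (ht : PolyTime fun x : σ × α => t x.1 x.2) : PolyTime fun s => (l s).any (t s) :=
  (hl.all (t := fun s a => !t s a) ht.not).not.congr fun s => by
    induction l s <;> simp_all

/-- Indexing, with the index in unary. -/
theorem getD {l : σ → List α} {u : σ → List Unit} {d : σ → α} (hl : PolyTime l) (hu : PolyTime u)
    (hd : PolyTime d) : PolyTime fun s => (l s).getD (u s).length (d s) := by
  refine ((foldl_of_growth (f := fun _ (m : List α) (_ : Unit) => m.tail) hu hl snd'.fst.tail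
    ⟨0, fun s y x => ?_⟩).headD hd).congr fun s => ?_
  · cases y
    · exact Nat.le_add_right _ _
    · rw [treeSize_cons]; exact (Nat.le_add_left _ _).trans (Nat.le_add_right _ _)
  · generalize l s = m
    generalize u s = v
    induction v generalizing m with
    | nil => cases m <;> simp
    | cons x v ih =>
      rw [List.foldl_cons, ih]
      cases m <;> simp

end PolyTime

/-- The indices of a list, in unary. -/
def unaryIndices {α : Type} (l : List α) : List (List Unit) :=
  (List.range l.length).map fun n => List.replicate n ()

/-- Passing from the indices below k to those below k + 1 means incrementing all of them and adding
0 in front, which needs no arithmetic. -/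
theorem foldl_unaryIndices {α : Type} (l : List α) :
    l.foldl (fun m _ => [] :: m.map (List.cons ())) [] = unaryIndices l := by
  have key : ∀ (l : List α) k, l.foldl (fun m _ => [] :: m.map (List.cons ()))
      ((List.range k).map fun n => List.replicate n ()) =
        (List.range (k + l.length)).map fun n => List.replicate n () := by
    intro l
    induction l with
    | nil => exact fun k => rfl
    | cons x l ih =>
      intro k
      rw [List.foldl_cons, List.length_cons, ← add_assoc, add_right_comm, ← ih (k + 1),
        List.range_succ_eq_map]
      simp [Function.comp_def, List.replicate_succ]
  simpa [unaryIndices] using key l 0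

theorem treeSize_list_le {α : Type} [TreeEnc α] {l : List α} {B : ℕ}
    (h : ∀ x ∈ l, treeSize x ≤ B) : treeSize l ≤ 1 + l.length * (1 + B) := by
  induction l with
  | nil => simp
  | cons x l ih =>
    have h1 := ih fun y hy => h y (List.mem_cons_of_mem _ hy)
    have h2 := h x List.mem_cons_self
    rw [treeSize_cons, List.length_cons, Nat.add_mul]
    omega

theorem treeSize_replicate_unit (n : ℕ) : treeSize (List.replicate n ()) = 2 * n + 1 := by
  induction n with
  | zero => rfl
  | succ n ih => rw [List.replicate_succ, treeSize_cons, ih]; change 1 + 1 + _ = _; omega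

namespace PolyTime

variable {α σ : Type} [TreeEnc α] [TreeEnc σ]

theorem unaryIndices {l : σ → List α} (hl : PolyTime l) :
    PolyTime fun s => unaryIndices (l s) := by
  obtain ⟨p, hp⟩ := hl.size_le
  -- Each step lengthens every index, so `foldl_of_growth` does not apply; the size of each prefix
  -- fold is bounded directly, quadratically in the length.
  refine (foldl (f := fun _ (m : List (List Unit)) (_ : α) => [] :: m.map (List.cons ())) hl
    (const []) ((const []).cons (map snd'.fst ((const ()).cons snd')))
    ⟨1 + p * (1 + (2 * p + 1)), fun s l' hl' => ?_⟩).congr fun s => foldl_unaryIndices _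
  rw [foldl_unaryIndices]
  have hlen : l'.length ≤ p.eval (treeSize s) :=
    (length_le_treeSize l').trans ((treeSize_le_of_prefix hl').trans (hp s))
  refine (treeSize_list_le (B := 2 * p.eval (treeSize s) + 1) fun x hx => ?_).trans ?_
  · obtain ⟨n, hn, rfl⟩ := List.mem_map.1 hx
    rw [treeSize_replicate_unit]
    have := List.mem_range.1 hn
    omega
  · simp only [_root_.unaryIndices, List.length_map, List.length_range, Polynomial.eval_add,
      Polynomial.eval_mul, Polynomial.eval_one, Polynomial.eval_ofNat]
    exact Nat.add_le_add_left (Nat.mul_le_mul_right _ hlen) _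

end PolyTime

open TreeEnc Computability

/-! ### Natural numbers in binary -/

theorem encodeNat_zero : encodeNat 0 = [] := rfl

/-- With the least significant digit first, the root of the tree tests for zero, and its subtrees
are the parity and the half. For 0 the default subtrees of a leaf are also right. -/
theorem encodeNat_of_ne_zero {n : ℕ} (hn : n ≠ 0) :
    encodeNat n = n.bodd :: encodeNat (n / 2) := by
  have key : ∀ (b : Bool) (m : ℕ), Nat.bit b m ≠ 0 →
      encodeNat (Nat.bit b m) = b :: encodeNat m := by
    intro b m h
    rw [encodeNat, encodeNat, ← Num.ofNat'_eq, ← Num.ofNat'_eq, Num.ofNat'_bit]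
    rcases hm : Num.ofNat' m with _ | q
    · cases b
      · have : m = 0 := by
          have := congrArg (fun k : Num => (k : ℕ)) hm
          simpa [Num.ofNat'_eq] using this
        subst this; exact absurd rfl h
      · rfl
    · cases b <;> rfl
  have h := key n.bodd n.div2 (by rwa [Nat.bit_bodd_div2])
  rwa [Nat.bit_bodd_div2, Nat.div2_val] at h

instance : TreeEnc ℕ := ⟨fun n => enc (encodeNat n)⟩

theorem enc_zero : enc (0 : ℕ) = .leaf := rfl

theorem enc_nat {n : ℕ} (hn : n ≠ 0) : enc n = .node (enc n.bodd) (enc (n / 2)) := by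
  change enc (encodeNat n) = _
  rw [encodeNat_of_ne_zero hn]; rfl

theorem treeSize_zero : treeSize (0 : ℕ) = 1 := rfl

theorem treeSize_nat {n : ℕ} (hn : n ≠ 0) :
    treeSize n = 1 + treeSize n.bodd + treeSize (n / 2) := by
  unfold treeSize; rw [enc_nat hn]; rfl

/-- A digit costs one node and at most three vertices for the Boolean. Together with
`lt_two_pow_treeSize` this translates between bounds on values and bounds on sizes. -/
theorem treeSize_nat_le {n k : ℕ} (h : n < 2 ^ k) : treeSize n ≤ 1 + 4 * k := by
  induction k generalizing n with
  | zero => obtain rfl : n = 0 := by simpa using h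
            simp [treeSize_zero]
  | succ k ih =>
    rcases eq_or_ne n 0 with rfl | hn
    · rw [treeSize_zero]; omega
    · rw [treeSize_nat hn]
      have := ih (n := n / 2) (by rw [pow_succ] at h; omega)
      have := treeSize_bool n.bodd
      omega

theorem lt_two_pow_treeSize (n : ℕ) : n < 2 ^ treeSize n := by
  induction n using Nat.strong_induction_on with
  | _ n ih =>
    rcases eq_or_ne n 0 with rfl | hn
    · simp
    · have h := ih (n / 2) (by omega)
      rw [treeSize_nat hn]
      have h1 := treeSize_pos n.bodd
      have h2 : 2 ^ (1 + treeSize (n / 2)) ≤ 2 ^ (1 + treeSize n.bodd + treeSize (n / 2)) :=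
        Nat.pow_le_pow_right (by norm_num) (by omega)
      rw [pow_add] at h2
      omega

theorem lt_two_pow_length (n : ℕ) : n < 2 ^ (encodeNat n).length := by
  induction n using Nat.strong_induction_on with
  | _ n ih =>
    rcases eq_or_ne n 0 with rfl | hn
    · simp
    · have h := ih (n / 2) (by omega)
      rw [encodeNat_of_ne_zero hn, List.length_cons, pow_succ]
      omega

theorem treeSize_half_le (n : ℕ) : treeSize (n / 2) ≤ treeSize n := by
  rcases eq_or_ne n 0 with rfl | hn
  · rfl
  · rw [treeSize_nat hn]; omega

theorem treeSize_bit_le (b : Bool) (n : ℕ) : treeSize (Nat.bit b n) ≤ treeSize n + 4 := by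
  rcases eq_or_ne (Nat.bit b n) 0 with h | h
  · rw [h, treeSize_zero]; omega
  · rw [treeSize_nat h, Nat.bit_div_two]
    have := treeSize_bool (Nat.bit b n).bodd
    omega

/-- One step of binary addition: the summands, the carry and the digits of the sum so far. -/
def addStep (z : ℕ × ℕ × Bool × List Bool) : ℕ × ℕ × Bool × List Bool :=
  (z.1 / 2, z.2.1 / 2,
    bif z.1.bodd then z.2.1.bodd || z.2.2.1 else z.2.1.bodd && z.2.2.1,
    (xor (xor z.1.bodd z.2.1.bodd) z.2.2.1) :: z.2.2.2)

/-- The number whose binary digits are those of `n` preceded by the reverse of `l`. -/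
def pushDigits (l : List Bool) (n : ℕ) : ℕ := l.foldl (fun n b => Nat.bit b n) n

/-- The invariant is the number whose low digits have been emitted and whose high part is the
remaining `x + y + c`. Only the length of `fuel` matters; when it is used up both summands are 0,
and the carry is the top part. -/
theorem foldl_addStep (fuel : List Bool) (x y : ℕ) (hx : x < 2 ^ fuel.length)
    (hy : y < 2 ^ fuel.length) : ∀ (c : Bool) (out : List Bool),
    (fun z => pushDigits z.2.2.2 z.2.2.1.toNat)
      (fuel.foldl (fun z _ => addStep z) (x, y, c, out)) = pushDigits out (x + y + c.toNat) := by
  induction fuel generalizing x y with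
  | nil =>
    intro c out
    obtain rfl : x = 0 := by simpa using hx
    obtain rfl : y = 0 := by simpa using hy
    simp
  | cons d fuel ih =>
    intro c out
    rw [List.length_cons, pow_succ] at hx hy
    rw [List.foldl_cons, addStep, ih (x / 2) (y / 2) (by omega) (by omega)]
    change pushDigits out (Nat.bit _ _) = _
    congr 1
    have hx' := Nat.bodd_add_div2 x
    have hy' := Nat.bodd_add_div2 y
    rw [Nat.div2_val] at hx' hy'
    generalize x / 2 = x' at *
    generalize y / 2 = y' at *
    rw [← hx', ← hy']
    rw [Nat.bit_val]
    cases x.bodd <;> cases y.bodd <;> cases c <;> simp <;> omega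

/-- One step of binary comparison. -/
def leStep (z : ℕ × ℕ × Bool) : ℕ × ℕ × Bool :=
  (z.1 / 2, z.2.1 / 2, bif z.1.bodd == z.2.1.bodd then z.2.2 else z.2.1.bodd)

/-- Digits are read from the lowest up; the flag is the verdict on the digits read so far, and a
higher position where the digits differ overrules it. -/
theorem foldl_leStep (fuel : List Bool) (x y : ℕ) (hx : x < 2 ^ fuel.length)
    (hy : y < 2 ^ fuel.length) : ∀ c : Bool,
    (fuel.foldl (fun z _ => leStep z) (x, y, c)).2.2 = decide (x < y ∨ x = y ∧ c = true) := by
  induction fuel generalizing x y with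
  | nil =>
    intro c
    obtain rfl : x = 0 := by simpa using hx
    obtain rfl : y = 0 := by simpa using hy
    simp
  | cons d fuel ih =>
    intro c
    rw [List.length_cons, pow_succ] at hx hy
    rw [List.foldl_cons, leStep, ih (x / 2) (y / 2) (by omega) (by omega)]
    have hx' := Nat.bodd_add_div2 x
    have hy' := Nat.bodd_add_div2 y
    rw [Nat.div2_val] at hx' hy'
    rw [decide_eq_decide]
    cases hbx : x.bodd <;> cases hby : y.bodd <;> cases c <;>
      simp [hbx, hby] at hx' hy' ⊢ <;> omega

namespace PolyTime

variable {σ : Type} [TreeEnc σ]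

theorem digits {f : σ → ℕ} (hf : PolyTime f) : PolyTime fun s => encodeNat (f s) :=
  hf.congr_enc fun _ => rfl

theorem isZero {f : σ → ℕ} (hf : PolyTime f) : PolyTime fun s => decide (f s = 0) :=
  (treeIsNode.comp hf.enc_of).not.congr fun s => by
    by_cases h : f s = 0
    · simp [h, enc_zero, DTree.isNode]
    · simp [h, enc_nat, DTree.isNode]

theorem half {f : σ → ℕ} (hf : PolyTime f) : PolyTime fun s => f s / 2 :=
  of_enc ((treeSnd.comp hf.enc_of).congr fun s => by
    by_cases h : f s = 0
    · simp [h, enc_zero, DTree.snd]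
    · simp [enc_nat h, DTree.snd])

theorem bodd {f : σ → ℕ} (hf : PolyTime f) : PolyTime fun s => (f s).bodd :=
  of_enc ((treeFst.comp hf.enc_of).congr fun s => by
    by_cases h : f s = 0
    · simp [h, enc_zero, DTree.fst]
    · simp [enc_nat h, DTree.fst])

theorem bit {b : σ → Bool} {f : σ → ℕ} (hb : PolyTime b) (hf : PolyTime f) :
    PolyTime fun s => Nat.bit (b s) (f s) := by
  -- The digit 0 in front of the number 0 would leave a superfluous leading zero, so this case is
  -- separate.
  refine of_enc ((bcond (hb.not.and hf.isZero) (const DTree.leaf) (hb.pair hf).enc_of).congr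
    fun s => ?_)
  by_cases h : Nat.bit (b s) (f s) = 0
  · have h' := h
    rw [Nat.bit_eq_zero_iff] at h'
    rw [h, h'.1, h'.2]; rfl
  · rw [enc_nat h, Nat.bodd_bit, Nat.bit_div_two]
    have : (!b s && decide (f s = 0)) = false := by
      rw [Nat.bit_eq_zero_iff] at h
      rcases hbs : b s <;> simp_all
    rw [this]; rfl

theorem add {f g : σ → ℕ} (hf : PolyTime f) (hg : PolyTime g) :
    PolyTime fun s => f s + g s := by
  have hz : PolyTime fun x : σ × (ℕ × ℕ × Bool × List Bool) × Bool => x.2.1 := snd'.fst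
  have hx := hz.fst.bodd
  have hy := hz.snd.fst.bodd
  have hc := hz.snd.snd.fst
  have hxor : ∀ {u v : σ × (ℕ × ℕ × Bool × List Bool) × Bool → Bool},
      PolyTime u → PolyTime v → PolyTime fun x => xor (u x) (v x) := fun {u v} hu hv =>
    (hu.beq hv).not.congr fun x => by cases u x <;> cases v x <;> rfl
  have h1 := foldl_of_growth (init := fun s => (f s, g s, false, ([] : List Bool)))
    (f := fun _ z _ => addStep z) (hf.digits.append hg.digits)
    (hf.pair (hg.pair (const _)))
    (hz.fst.half.pair (hz.snd.fst.half.pair ((bcond hx (hy.or hc) (hy.and hc)).pair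
      ((hxor (hxor hx hy) hc).cons hz.snd.snd.snd))))
    ⟨10, fun s y x => by
      obtain ⟨a, b, c, l⟩ := y
      have := treeSize_half_le a
      have := treeSize_half_le b
      have := treeSize_bool (xor (xor a.bodd b.bodd) c)
      have := treeSize_bool (bif a.bodd then b.bodd || c else b.bodd && c)
      simp only [addStep, treeSize_pair, treeSize_cons, Polynomial.eval_ofNat]
      omega⟩
  have h2 : PolyTime fun z : ℕ × ℕ × Bool × List Bool => pushDigits z.2.2.2 z.2.2.1.toNat :=
    foldl_of_growth (f := fun _ n b => Nat.bit b n) snd'.snd.snd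
      ((bcond snd'.snd.fst (const 1) (const 0)).congr fun z => by cases z.2.2.1 <;> rfl)
      (snd'.snd.bit snd'.fst)
      ⟨4, fun s y x => by simpa using treeSize_bit_le x y⟩
  refine (h2.comp h1).congr fun s => ?_
  -- The two digit lists concatenated are long enough as fuel for either summand.
  have h := foldl_addStep (encodeNat (f s) ++ encodeNat (g s)) (f s) (g s) ?_ ?_ false []
  · simpa [pushDigits] using h
  · exact (lt_two_pow_length _).trans_le (Nat.pow_le_pow_right (by norm_num) (by simp))
  · exact (lt_two_pow_length _).trans_le (Nat.pow_le_pow_right (by norm_num) (by simp))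

theorem ble {f g : σ → ℕ} (hf : PolyTime f) (hg : PolyTime g) :
    PolyTime fun s => decide (f s ≤ g s) := by
  have hz : PolyTime fun x : σ × (ℕ × ℕ × Bool) × Bool => x.2.1 := snd'.fst
  have hx := hz.fst.bodd
  have hy := hz.snd.fst.bodd
  have h1 := foldl_of_growth (init := fun s => (f s, g s, true))
    (f := fun _ z _ => leStep z) (hf.digits.append hg.digits)
    (hf.pair (hg.pair (const _)))
    (hz.fst.half.pair (hz.snd.fst.half.pair (bcond (hx.beq hy) hz.snd.snd hy)))
    ⟨10, fun s y x => by
      obtain ⟨a, b, c⟩ := y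
      have := treeSize_half_le a
      have := treeSize_half_le b
      have := treeSize_bool (bif a.bodd == b.bodd then c else b.bodd)
      simp only [leStep, treeSize_pair, Polynomial.eval_ofNat]
      omega⟩
  refine h1.snd.snd.congr fun s => ?_
  rw [foldl_leStep (encodeNat (f s) ++ encodeNat (g s)) (f s) (g s) ?_ ?_ true]
  · simp [le_iff_lt_or_eq]
  · exact (lt_two_pow_length _).trans_le (Nat.pow_le_pow_right (by norm_num) (by simp))
  · exact (lt_two_pow_length _).trans_le (Nat.pow_le_pow_right (by norm_num) (by simp))

theorem natEq {f g : σ → ℕ} (hf : PolyTime f) (hg : PolyTime g) :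
    PolyTime fun s => decide (f s = g s) :=
  ((hf.ble hg).and (hg.ble hf)).congr fun s => by
    rw [Bool.eq_iff_iff]; simp [le_antisymm_iff]

/-- Horner's scheme from the most significant digit: double, and add `g s` if the digit is 1. -/
theorem mul {f g : σ → ℕ} (hf : PolyTime f) (hg : PolyTime g) :
    PolyTime fun s => f s * g s := by
  obtain ⟨p, hp⟩ := hf.digits.size_le
  obtain ⟨q, hq⟩ := hg.size_le
  have hb : PolyTime fun x : σ × ℕ × Bool => x.2.2 := snd'.snd
  have h := foldl (l := fun s => (encodeNat (f s)).reverse) (init := fun _ => 0)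
    (f := fun s z b => Nat.bit false z + bif b then g s else 0) hf.digits.reverse (const 0)
    (((const false).bit snd'.fst).add (bcond hb (hg.comp fst') (const 0)))
    ⟨1 + 4 * (p + q), fun s l' hl' => ?_⟩
  · refine h.congr fun s => ?_
    rw [List.foldl_reverse]
    generalize f s = n
    induction n using Nat.strong_induction_on with
    | _ n ih =>
      rcases eq_or_ne n 0 with rfl | hn
      · simp [encodeNat_zero]
      · rw [encodeNat_of_ne_zero hn, List.foldr_cons, ih (n / 2) (by omega)]
        have h := Nat.bodd_add_div2 n
        rw [Nat.div2_val] at h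
        conv_rhs => rw [← h]
        rw [Nat.bit_val]
        cases n.bodd <;> simp <;> ring
  -- After k digits the accumulator is at most (2 ^ k - 1) * g s. The form without subtraction
  -- survives doubling and adding `g s`.
  · have key : ∀ (l : List Bool) (z k : ℕ), z + g s ≤ 2 ^ k * g s →
        l.foldl (fun z b => Nat.bit false z + bif b then g s else 0) z + g s ≤
          2 ^ (k + l.length) * g s := by
      intro l
      induction l with
      | nil => exact fun z k h => h
      | cons b l ih =>
        intro z k h
        rw [List.foldl_cons, List.length_cons, add_comm l.length, ← add_assoc]
        refine ih _ _ ?_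
        rw [pow_succ, Nat.bit_val]
        cases b <;> simp <;> linarith
    have h1 := key l' 0 0 (by simp)
    have hlen : l'.length ≤ p.eval (treeSize s) := by
      have := hl'.length_le
      rw [List.length_reverse] at this
      exact this.trans ((length_le_treeSize _).trans (hp s))
    have h2 : 2 ^ (0 + l'.length) * g s < 2 ^ (p.eval (treeSize s) + q.eval (treeSize s)) := by
      rw [pow_add _ (p.eval _), zero_add]
      refine lt_of_le_of_lt (Nat.mul_le_mul_right _ (Nat.pow_le_pow_right (by norm_num) hlen))
        (Nat.mul_lt_mul_of_pos_left ?_ (by positivity))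
      exact (lt_two_pow_treeSize _).trans_le (Nat.pow_le_pow_right (by norm_num) (hq s))
    have h3 := treeSize_nat_le (lt_of_le_of_lt (Nat.le_of_add_right_le h1) h2)
    simpa using h3

end PolyTime

open TreeEnc Computability

/-! ### Fractions -/

/-- The fraction `(x.1 - x.2.1) / x.2.2`. -/
abbrev Fraction := ℕ × ℕ × ℕ

namespace Fraction

/-- The value of a fraction. -/
def val (x : Fraction) : ℚ := ((x.1 : ℚ) - x.2.1) / x.2.2

/-- The fraction `0 / 1`. -/
def zero : Fraction := (0, 0, 1)

/-- Addition without reduction. -/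
def add (x y : Fraction) : Fraction :=
  (x.1 * y.2.2 + y.1 * x.2.2, x.2.1 * y.2.2 + y.2.1 * x.2.2, x.2.2 * y.2.2)

/-- Multiplication without reduction. -/
def mul (x y : Fraction) : Fraction :=
  (x.1 * y.1 + x.2.1 * y.2.1, x.1 * y.2.1 + x.2.1 * y.1, x.2.2 * y.2.2)

/-- Comparison. -/
def le (x y : Fraction) : Bool :=
  decide (x.1 * y.2.2 + y.2.1 * x.2.2 ≤ y.1 * x.2.2 + x.2.1 * y.2.2)

/-- The sum of a list. -/
def sum (l : List Fraction) : Fraction := l.foldl add zero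

/-- The fraction of a rational number. -/
def ofRat (q : ℚ) : Fraction :=
  (bif decide (q < 0) then 0 else q.num.natAbs, bif decide (q < 0) then q.num.natAbs else 0, q.den)

theorem val_zero : zero.val = 0 := by simp [val, zero]

theorem val_add {x y : Fraction} (hx : 0 < x.2.2) (hy : 0 < y.2.2) :
    (add x y).val = x.val + y.val := by
  have hx' : (x.2.2 : ℚ) ≠ 0 := by positivity
  have hy' : (y.2.2 : ℚ) ≠ 0 := by positivity
  simp only [val, add]
  push_cast
  field_simp
  ring

theorem val_mul (x y : Fraction) : (mul x y).val = x.val * y.val := by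
  simp only [val, mul, div_mul_div_comm]
  push_cast
  ring

theorem le_eq_true_iff {x y : Fraction} (hx : 0 < x.2.2) (hy : 0 < y.2.2) :
    le x y = true ↔ x.val ≤ y.val := by
  have hx' : (0 : ℚ) < x.2.2 := by positivity
  have hy' : (0 : ℚ) < y.2.2 := by positivity
  rw [val, val, div_le_div_iff₀ hx' hy', le, decide_eq_true_iff, ← Nat.cast_le (α := ℚ)]
  push_cast
  constructor <;> intro h <;> linarith

theorem den_ofRat (q : ℚ) : 0 < (ofRat q).2.2 := q.den_pos

theorem val_ofRat (q : ℚ) : (ofRat q).val = q := by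
  have h : ((ofRat q).1 : ℚ) - (ofRat q).2.1 = q.num := by
    by_cases hq : q < 0
    · have : q.num < 0 := Rat.num_neg.2 hq
      have h2 : (q.num.natAbs : ℤ) = -q.num := by omega
      have h3 : (q.num.natAbs : ℚ) = -q.num := by rw [← Int.cast_natCast, h2, Int.cast_neg]
      simp only [ofRat, hq, decide_true, cond_true, Nat.cast_zero, h3]; ring
    · have : 0 ≤ q.num := Rat.num_nonneg.2 (not_lt.1 hq)
      have h2 : (q.num.natAbs : ℤ) = q.num := by omega
      have h3 : (q.num.natAbs : ℚ) = q.num := by rw [← Int.cast_natCast, h2]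
      simp only [ofRat, hq, decide_false, cond_false, Nat.cast_zero, h3]; ring
  rw [val, h]
  exact Rat.num_div_den q

theorem sum_spec (l : List Fraction) (hl : ∀ x ∈ l, 0 < x.2.2) :
    0 < (sum l).2.2 ∧ (sum l).val = (l.map val).sum := by
  have key : ∀ (l : List Fraction) (y : Fraction), 0 < y.2.2 → (∀ x ∈ l, 0 < x.2.2) →
      0 < (l.foldl add y).2.2 ∧ (l.foldl add y).val = y.val + (l.map val).sum := by
    intro l
    induction l with
    | nil => exact fun y hy _ => ⟨hy, by simp⟩
    | cons x l ih =>
      intro y hy h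
      have hx := h x List.mem_cons_self
      have := ih (add y x) (Nat.mul_pos hy hx) fun z hz => h z (List.mem_cons_of_mem _ hz)
      rw [val_add hy hx] at this
      exact ⟨this.1, by rw [List.foldl_cons, this.2, List.map_cons, List.sum_cons, add_assoc]⟩
  simpa [sum, val_zero] using key l zero Nat.one_pos hl

/-- All three components are less than `2 ^ k`. -/
def Bounded (k : ℕ) (x : Fraction) : Prop := x.1 < 2 ^ k ∧ x.2.1 < 2 ^ k ∧ x.2.2 < 2 ^ k

/-- Cross-multiplication adds the bit lengths, and the sum of two such products needs one bit more.
-/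
theorem Bounded.add {j k : ℕ} {x y : Fraction} (hx : x.Bounded j) (hy : y.Bounded k) :
    (add x y).Bounded (j + (k + 1)) := by
  obtain ⟨h1, h2, h3⟩ := hx
  obtain ⟨h4, h5, h6⟩ := hy
  have e : 2 ^ (j + (k + 1)) = 2 ^ j * 2 ^ k + 2 ^ j * 2 ^ k := by ring
  rw [Bounded, e]
  refine ⟨?_, ?_, ?_⟩
  · have := Nat.mul_lt_mul'' h1 h6
    have := Nat.mul_lt_mul'' h4 h3
    rw [mul_comm (2 ^ k)] at this
    simp only [Fraction.add]; omega
  · have := Nat.mul_lt_mul'' h2 h6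
    have := Nat.mul_lt_mul'' h5 h3
    rw [mul_comm (2 ^ k)] at this
    simp only [Fraction.add]; omega
  · have := Nat.mul_lt_mul'' h3 h6
    simp only [Fraction.add]; omega

theorem bounded_treeSize (x : Fraction) : x.Bounded (treeSize x) := by
  obtain ⟨a, b, c⟩ := x
  simp only [treeSize_pair, Bounded]
  exact ⟨(lt_two_pow_treeSize a).trans_le (Nat.pow_le_pow_right (by norm_num) (by omega)),
    (lt_two_pow_treeSize b).trans_le (Nat.pow_le_pow_right (by norm_num) (by omega)),
    (lt_two_pow_treeSize c).trans_le (Nat.pow_le_pow_right (by norm_num) (by omega))⟩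

theorem Bounded.treeSize_le {k : ℕ} {x : Fraction} (hx : x.Bounded k) :
    treeSize x ≤ 5 + 12 * k := by
  obtain ⟨a, b, c⟩ := x
  have h1 := treeSize_nat_le hx.1
  have h2 := treeSize_nat_le hx.2.1
  have h3 := treeSize_nat_le hx.2.2
  simp only [treeSize_pair] at *
  omega

/-- Every summand contributes the same k + 1 bits, so the bit length grows linearly with the list
although nothing is reduced. -/
theorem Bounded.foldl_add {k : ℕ} (l : List Fraction) (hl : ∀ x ∈ l, x.Bounded k) :
    ∀ {j : ℕ} {y : Fraction}, y.Bounded j →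
      (l.foldl Fraction.add y).Bounded (j + l.length * (k + 1)) := by
  induction l with
  | nil => exact fun h => by simpa using h
  | cons x l ih =>
    intro j y h
    have h1 := ih (fun z hz => hl z (List.mem_cons_of_mem _ hz)) (h.add (hl x List.mem_cons_self))
    have e : j + (k + 1) + l.length * (k + 1) = j + (x :: l).length * (k + 1) := by
      rw [List.length_cons]; ring
    rwa [e] at h1

end Fraction

namespace PolyTime

variable {σ : Type} [TreeEnc σ] {f g : σ → Fraction}

theorem fracAdd (hf : PolyTime f) (hg : PolyTime g) :
    PolyTime fun s => Fraction.add (f s) (g s) :=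
  ((hf.fst.mul hg.snd.snd).add (hg.fst.mul hf.snd.snd)).pair
    (((hf.snd.fst.mul hg.snd.snd).add (hg.snd.fst.mul hf.snd.snd)).pair
      (hf.snd.snd.mul hg.snd.snd))

theorem fracMul (hf : PolyTime f) (hg : PolyTime g) :
    PolyTime fun s => Fraction.mul (f s) (g s) :=
  ((hf.fst.mul hg.fst).add (hf.snd.fst.mul hg.snd.fst)).pair
    (((hf.fst.mul hg.snd.fst).add (hf.snd.fst.mul hg.fst)).pair
      (hf.snd.snd.mul hg.snd.snd))

theorem fracLe (hf : PolyTime f) (hg : PolyTime g) :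
    PolyTime fun s => Fraction.le (f s) (g s) :=
  ((hf.fst.mul hg.snd.snd).add (hg.snd.fst.mul hf.snd.snd)).ble
    ((hg.fst.mul hf.snd.snd).add (hf.snd.fst.mul hg.snd.snd))

theorem fracSum {l : σ → List Fraction} (hl : PolyTime l) :
    PolyTime fun s => Fraction.sum (l s) := by
  obtain ⟨p, hp⟩ := hl.size_le
  refine foldl (f := fun _ => Fraction.add) hl (const Fraction.zero)
    (fracAdd snd'.fst snd'.snd) ⟨5 + 12 * (1 + p * (p + 1)), fun s l' hl' => ?_⟩
  have hsz := (treeSize_le_of_prefix hl').trans (hp s)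
  -- The components of 0 / 1 are below 2 ^ 1, hence `j := 1`; the size of the whole list bounds the
  -- bits of each member.
  have h := Fraction.Bounded.foldl_add (k := p.eval (treeSize s)) l' (fun x hx => ?_)
    (j := 1) (y := Fraction.zero) (by simp [Fraction.Bounded, Fraction.zero])
  · refine h.treeSize_le.trans ?_
    simp only [Polynomial.eval_add, Polynomial.eval_mul, Polynomial.eval_one,
      Polynomial.eval_ofNat]
    have := Nat.mul_le_mul_right (p.eval (treeSize s) + 1) ((length_le_treeSize l').trans hsz)
    omega
  · have hx' := (treeSize_le_of_mem hx).trans hsz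
    have h2 : 2 ^ treeSize x ≤ 2 ^ p.eval (treeSize s) := Nat.pow_le_pow_right (by norm_num) hx'
    obtain ⟨h3, h4, h5⟩ := x.bounded_treeSize
    exact ⟨h3.trans_le h2, h4.trans_le h2, h5.trans_le h2⟩

theorem length {α : Type} [TreeEnc α] {l : σ → List α} (hl : PolyTime l) :
    PolyTime fun s => (l s).length := by
  obtain ⟨p, hp⟩ := hl.size_le
  have key : ∀ (l : List α) n, l.foldl (fun n _ => n + 1) n = n + l.length := by
    intro l
    induction l with
    | nil => exact fun n => rfl
    | cons x l ih => intro n; rw [List.foldl_cons, ih, List.length_cons]; omega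
  refine (foldl (f := fun _ n _ => n + 1) hl (const 0) (snd'.fst.add (const 1))
    ⟨1 + 4 * p, fun s l' hl' => ?_⟩).congr fun s => by rw [key, zero_add]
  rw [key, zero_add]
  have := (length_le_treeSize l').trans ((treeSize_le_of_prefix hl').trans (hp s))
  have := treeSize_nat_le (Nat.lt_two_pow_self (n := l'.length))
  simp only [Polynomial.eval_add, Polynomial.eval_mul, Polynomial.eval_one, Polynomial.eval_ofNat]
  omega

end PolyTime

/-! ## The decision procedures -/

/-- A row of the table: the coordinates, the probability and the utilities of a state. -/
abbrev TableRow := List ℕ × Fraction × List Fraction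

namespace TableRow

/-- Whether two coordinate lists agree where the mask is set. -/
def agree (mask : List Bool) (s t : List ℕ) : Bool :=
  (unaryIndices mask).all fun j =>
    !mask.getD j.length false || decide (s.getD j.length 0 = t.getD j.length 0)

/-- The rows in the fiber of `s`. -/
def fiber (mask : List Bool) (rows : List TableRow) (s : TableRow) : List TableRow :=
  rows.filter fun r => agree mask r.1 s.1

/-- The expected utility of an action, before normalization, on a list of rows. -/
def weight (rows : List TableRow) (j : List Unit) : Fraction :=
  Fraction.sum (rows.map fun r => Fraction.mul r.2.1 (r.2.2.getD j.length Fraction.zero))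

/-- Whether a list of rows has positive probability. -/
def positive (rows : List TableRow) : Bool :=
  !Fraction.le (Fraction.sum (rows.map fun r => r.2.1)) Fraction.zero

/-- Whether the rows have the same optimal actions as the row `s`. -/
def sameOpt (rows : List TableRow) (s : TableRow) : Bool :=
  (unaryIndices s.2.2).all fun j =>
    ((unaryIndices s.2.2).all fun i => Fraction.le (weight rows i) (weight rows j)) ==
      ((unaryIndices s.2.2).all fun i => Fraction.le (s.2.2.getD i.length Fraction.zero)
        (s.2.2.getD j.length Fraction.zero))

/-- The optimizer is preserved at `s`. -/
def preserved (c : NullFiberConvention) (mask : List Bool) (rows : List TableRow)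
    (s : TableRow) : Bool :=
  match c with
  | .exempt => !positive (fiber mask rows s) || sameOpt (fiber mask rows s) s
  | .strict => positive (fiber mask rows s) && sameOpt (fiber mask rows s) s
  | .tie => sameOpt (fiber mask rows s) s

/-- The nonzero coordinates. -/
def support (s : TableRow) : List Bool := s.1.map fun n => !decide (n = 0)

/-- The decision procedure for minimum preservation. -/
def minimum (c : NullFiberConvention) (rows : List TableRow) (k : ℕ) : Bool :=
  rows.any fun t => decide ((t.support.filter id).length ≤ k) &&
    rows.all fun s => preserved c t.support rows s

/-- The decision procedure for anchor preservation. -/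
def anchor (c : NullFiberConvention) (rows : List TableRow) (mask : List Bool) : Bool :=
  rows.any fun t => rows.all fun s => !agree mask s.1 t.1 || preserved c mask rows s

end TableRow

/-! ### The decision procedures run in polynomial time -/

namespace PolyTime

variable {σ : Type} [TreeEnc σ] {mask : σ → List Bool} {rows : σ → List TableRow}
  {s : σ → TableRow}

theorem agree {u v : σ → List ℕ} (hm : PolyTime mask) (hu : PolyTime u) (hv : PolyTime v) :
    PolyTime fun x => TableRow.agree (mask x) (u x) (v x) :=
  hm.unaryIndices.all <| ((hm.comp fst').getD snd' (const _)).not.or <|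
    ((hu.comp fst').getD snd' (const 0)).natEq ((hv.comp fst').getD snd' (const 0))

theorem fiber (hm : PolyTime mask) (hr : PolyTime rows) (hs : PolyTime s) :
    PolyTime fun x => TableRow.fiber (mask x) (rows x) (s x) :=
  hr.filter <| (hm.comp fst').agree snd'.fst (hs.comp fst').fst

theorem weight {j : σ → List Unit} (hr : PolyTime rows) (hj : PolyTime j) :
    PolyTime fun x => TableRow.weight (rows x) (j x) :=
  fracSum <| hr.map <| snd'.snd.fst.fracMul (snd'.snd.snd.getD (hj.comp fst') (const _))

theorem positive (hr : PolyTime rows) : PolyTime fun x => TableRow.positive (rows x) := by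
  have h : PolyTime fun x => (rows x).map fun r => r.2.1 := hr.map (f := fun _ r => r.2.1) snd'.snd.fst
  exact (h.fracSum.fracLe (const Fraction.zero)).not

theorem sameOpt (hr : PolyTime rows) (hs : PolyTime s) :
    PolyTime fun x => TableRow.sameOpt (rows x) (s x) :=
  hs.snd.snd.unaryIndices.all <|
    ((hs.snd.snd.comp fst').unaryIndices.all <|
      ((hr.comp fst'.fst).weight snd').fracLe ((hr.comp fst'.fst).weight fst'.snd)).beq
    ((hs.snd.snd.comp fst').unaryIndices.all <|
      ((hs.snd.snd.comp fst'.fst).getD snd' (const _)).fracLe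
        ((hs.snd.snd.comp fst'.fst).getD fst'.snd (const _)))

theorem preserved (c : NullFiberConvention) (hm : PolyTime mask) (hr : PolyTime rows)
    (hs : PolyTime s) : PolyTime fun x => TableRow.preserved c (mask x) (rows x) (s x) := by
  have hF := hm.fiber hr hs
  cases c with
  | exempt => exact hF.positive.not.or (hF.sameOpt hs)
  | strict => exact hF.positive.and (hF.sameOpt hs)
  | tie => exact hF.sameOpt hs

theorem support (hs : PolyTime s) : PolyTime fun x => (s x).support :=
  hs.fst.map snd'.isZero.not

theorem minimum (c : NullFiberConvention) {k : σ → ℕ} (hr : PolyTime rows) (hk : PolyTime k) :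
    PolyTime fun x => TableRow.minimum c (rows x) (k x) :=
  hr.any <| ((snd'.support.filter (t := fun _ => _root_.id) snd').length.ble (hk.comp fst')).and <|
    (hr.comp fst').all <| preserved c fst'.snd.support (hr.comp fst'.fst) snd'

theorem anchor (c : NullFiberConvention) (hr : PolyTime rows) (hm : PolyTime mask) :
    PolyTime fun x => TableRow.anchor c (rows x) (mask x) :=
  hr.any <| (hr.comp fst').all <| ((hm.comp fst'.fst).agree snd'.fst fst'.snd.fst).not.or <|
    preserved c (hm.comp fst'.fst) (hr.comp fst'.fst) snd'

end PolyTime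

open TreeEnc Computability

/-! ## Parsing -/

/-- A code for the symbols of the input alphabet. -/
def symCode : Γ' → Bool × Bool × Bool
  | .blank => (true, true, true)
  | .bit b => (false, b, false)
  | .bra => (true, false, false)
  | .ket => (true, false, true)
  | .comma => (true, true, false)

instance : TreeEnc Γ' := ⟨fun s => enc (symCode s)⟩

/-- The members of `α`, given by the reversed words that `e` assigns to them. -/
structure WordInput {α : Type} (e : α → List Γ') where
  /-- The member. -/
  val : α

instance {α : Type} (e : α → List Γ') : TreeEnc (WordInput e) := ⟨fun x => enc (e x.val).reverse⟩

/-- One step of the parser, which reads the word from right to left and keeps a stack of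
lists (as trees) that are under construction. -/
def parseStep (st : List DTree) : Γ' → List DTree
  | .blank => st
  | .bit b => .node (.node (enc b) (st.headD .leaf).fst) (st.headD .leaf).snd :: st.tail
  | .bra => .node (st.headD .leaf) (st.tail.headD .leaf) :: st.tail.tail
  | .ket => .leaf :: st
  | .comma => .node .leaf (st.headD .leaf) :: st.tail

/-- The parser. -/
def parseFrom (w : List Γ') (st : List DTree) : List DTree :=
  w.foldr (fun a st => parseStep st a) st

theorem parseFrom_append (v w : List Γ') (st : List DTree) :
    parseFrom (v ++ w) st = parseFrom v (parseFrom w st) := List.foldr_append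

theorem treeSize_parseStep_le (st : List DTree) (a : Γ') :
    treeSize (parseStep st a) ≤ treeSize st + 20 := by
  have e : ∀ x y : DTree, treeSize (DTree.node x y) = 1 + treeSize x + treeSize y := fun _ _ => rfl
  have e0 : treeSize DTree.leaf = 1 := rfl
  have e1 : ∀ b : Bool, treeSize (enc b) ≤ 3 := treeSize_bool
  rcases a with _ | b | _ | _ | _
  · exact Nat.le_add_right _ _
  · have := e1 b
    rcases st with _ | ⟨_ | ⟨x, y⟩, st⟩ <;>
      (simp [parseStep, DTree.fst, DTree.snd, e, e0]; omega)
  · rcases st with _ | ⟨x, _ | ⟨y, st⟩⟩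
    · simp [parseStep, e, e0]
    · simp [parseStep, e, e0]; omega
    · simp [parseStep, e]; omega
  · simp [parseStep, e0]; omega
  · rcases st with _ | ⟨x, st⟩
    · simp [parseStep, e, e0]
    · simp [parseStep, e, e0]; omega

namespace PolyTime

variable {σ α β : Type} [TreeEnc σ] [TreeEnc α] [TreeEnc β]

theorem node {f g : σ → DTree} (hf : PolyTime f) (hg : PolyTime g) :
    PolyTime fun x => DTree.node (f x) (g x) :=
  (hf.pair hg).congr_enc fun _ => rfl

theorem parseStep {st : σ → List DTree} {a : σ → Γ'} (hs : PolyTime st) (ha : PolyTime a) :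
    PolyTime fun x => parseStep (st x) (a x) := by
  have hc : PolyTime fun x => symCode (a x) := ha.congr_enc fun _ => rfl
  have hl : PolyTime fun _ : σ => DTree.leaf := const _
  have h0 := hs.headD hl
  refine (bcond hc.fst (bcond hc.snd.fst (bcond hc.snd.snd hs ((node hl h0).cons hs.tail))
    (bcond hc.snd.snd (hl.cons hs) ((node h0 (hs.tail.headD hl)).cons hs.tail.tail)))
    ((node (node hc.snd.fst.enc_of (treeFst.comp h0)) (treeSnd.comp h0)).cons hs.tail)).congr
    fun x => ?_
  cases a x <;> rfl

/-- `WordInput` stores the reversed word, so reading from right to left is a left fold. The single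
leaf at the start is the list that collects the top-level items. -/
theorem parseFrom {α : Type} {e : α → List Γ'} :
    PolyTime fun x : WordInput e => parseFrom (e x.val) [.leaf] :=
  (foldl_of_growth (l := fun x : WordInput e => (e x.val).reverse)
    (f := fun _ st a => _root_.parseStep st a)
    (id.congr_enc fun _ => rfl) (const [DTree.leaf]) (snd'.fst.parseStep snd'.snd)
    ⟨20, fun s y x => by simpa using treeSize_parseStep_le y x⟩).congr fun x => by
      rw [List.foldl_reverse]; rfl

end PolyTime

/-- One step of `pairUp`: the pairs so far and the member that waits for its partner. -/
def pairStep {α : Type} (z : List (α × α) × List α) (x : α) : List (α × α) × List α :=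
  (bif z.2.isEmpty then z.1 else (x, z.2.headD x) :: z.1, bif z.2.isEmpty then [x] else [])

/-- Group a list into pairs. -/
def pairUp {α : Type} (l : List α) : List (α × α) :=
  (l.foldr (fun x z => pairStep z x) ([], [])).1

/-- The parser leaves a rational number as two neighbouring list members and a table row as four;
grouping once or twice recovers them. -/
theorem pairUp_flatMap {α β : Type} (f g : β → α) (l : List β) :
    pairUp (l.flatMap fun x => [f x, g x]) = l.map fun x => (f x, g x) := by
  have : (l.flatMap fun x => [f x, g x]).foldr (fun x z => pairStep z x) ([], []) =
      (l.map fun x => (f x, g x), []) := by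
    induction l with
    | nil => rfl
    | cons x l ih =>
      simp only [List.flatMap_cons, List.cons_append, List.nil_append, List.foldr_cons, ih]
      rfl
  rw [pairUp, this]

theorem PolyTime.pairUp {σ α : Type} [TreeEnc σ] [TreeEnc α] {l : σ → List α} (hl : PolyTime l) :
    PolyTime fun x => pairUp (l x) := by
  have hz : PolyTime fun x : σ × (List (α × α) × List α) × α => x.2.1 := snd'.fst
  have hx : PolyTime fun x : σ × (List (α × α) × List α) × α => x.2.2 := snd'.snd
  have he := hz.snd.isEmpty
  refine (foldl_of_growth (f := fun _ z x => pairStep z x) hl.reverse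
    (const (([] : List (α × α)), ([] : List α)))
    ((bcond he hz.fst ((hx.pair (hz.snd.headD hx)).cons hz.fst)).pair
      (bcond he (hx.cons (const [])) (const [])))
    ⟨10 + Polynomial.X, fun s y x => ?_⟩).fst.congr fun x => by rw [List.foldl_reverse]; rfl
  obtain ⟨u, _ | ⟨v, w⟩⟩ := y
  · simp [pairStep]; omega
  · simp [pairStep]; omega

/-- This is the pair of the two trees that the parser produces for a rational number. -/
instance : TreeEnc ℚ := ⟨fun q => enc ((decide (q < 0), q.num.natAbs), q.den)⟩

/-- A list of rational numbers, written as the list of their numerators and denominators. -/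
structure FlatRats where
  /-- The list. -/
  list : List ℚ

/-- The numerators and denominators. -/
def FlatRats.flat (l : FlatRats) : List DTree :=
  l.list.flatMap fun q => [enc (decide (q < 0), q.num.natAbs), enc q.den]

instance : TreeEnc FlatRats := ⟨fun l => enc l.flat⟩

theorem enc_map_congr {α β γ : Type} [TreeEnc β] [TreeEnc γ] {f : α → β} {g : α → γ}
    (h : ∀ x, enc (f x) = enc (g x)) (l : List α) : enc (l.map f) = enc (l.map g) := by
  induction l with
  | nil => rfl
  | cons x l ih => simp [h, ih]

namespace PolyTime

variable {σ : Type} [TreeEnc σ]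

theorem ofRat {f : σ → ℚ} (hf : PolyTime f) : PolyTime fun x => Fraction.ofRat (f x) := by
  have h : PolyTime fun x => ((decide (f x < 0), (f x).num.natAbs), (f x).den) :=
    hf.congr_enc fun _ => rfl
  exact (bcond h.fst.fst (const 0) h.fst.snd).pair ((bcond h.fst.fst h.fst.snd (const 0)).pair h.snd)

theorem flatRats {f : σ → FlatRats} (hf : PolyTime f) : PolyTime fun x => (f x).list := by
  have h : PolyTime fun x => (f x).flat := hf.congr_enc fun _ => rfl
  refine h.pairUp.congr_enc fun x => ?_
  rw [FlatRats.flat, pairUp_flatMap]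
  conv_rhs => rw [← List.map_id (f x).list]
  apply enc_map_congr
  exact fun q => rfl

end PolyTime

/-! ### The parser on encoded instances -/

namespace ExplicitInstance

/-- The coordinates of a state. -/
def coords (D : ExplicitInstance) (s : ∀ i, Fin (D.numValues i)) : List ℕ :=
  (List.finRange D.numCoords).map fun i => (s i : ℕ)

/-- The utilities of all actions at a state. -/
def utils (D : ExplicitInstance) (s : ∀ i, Fin (D.numValues i)) : List ℚ :=
  (List.finRange D.numActions).map fun a => D.problem.util a s

/-- The row of the table for a state. -/
def row (D : ExplicitInstance) (s : ∀ i, Fin (D.numValues i)) : TableRow :=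
  (D.coords s, Fraction.ofRat (D.problem.prob s), (D.utils s).map Fraction.ofRat)

/-- The first half of a row. -/
def rowLeft (D : ExplicitInstance) (s : ∀ i, Fin (D.numValues i)) : DTree × DTree :=
  (enc (D.coords s), enc (decide (D.problem.prob s < 0), (D.problem.prob s).num.natAbs))

/-- The second half of a row. -/
def rowRight (D : ExplicitInstance) (s : ∀ i, Fin (D.numValues i)) : DTree × DTree :=
  (enc (D.problem.prob s).den, enc (FlatRats.mk (D.utils s)))

/-- The table as the parser sees it. -/
def flatTable (D : ExplicitInstance) : List DTree :=
  (D.states.flatMap fun s => [D.rowLeft s, D.rowRight s]).flatMap fun x => [x.1, x.2]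

theorem parseFrom_numeral (k : ℕ) (x : DTree) (st : List DTree) :
    parseFrom (encodeNumeral k) (x :: st) = .node (enc k) x :: st := by
  have key : ∀ l : List Bool, parseFrom (l.map Γ'.bit) (.node .leaf x :: st) =
      .node (enc l) x :: st := by
    intro l
    induction l with
    | nil => rfl
    | cons b l ih =>
      rw [List.map_cons, ← List.singleton_append, parseFrom_append, ih]
      rfl
  rw [encodeNumeral, parseFrom_append]
  exact key _

/-- The sign bit has no comma of its own, so it is prepended to the digits of the numerator. The
result is exactly the tree of the pair of sign and numerator. -/
theorem parseFrom_rational (q : ℚ) (x : DTree) (st : List DTree) :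
    parseFrom (encodeRational q) (x :: st) =
      .node (enc (decide (q < 0), q.num.natAbs)) (.node (enc q.den) x) :: st := by
  rw [encodeRational, ← List.singleton_append, parseFrom_append, parseFrom_append,
    parseFrom_numeral, parseFrom_numeral]
  rfl

theorem parseFrom_flatMap {α : Type} (e : α → List Γ') (f : α → DTree → DTree)
    (h : ∀ a x st, parseFrom (e a) (x :: st) = f a x :: st) (l : List α) (x : DTree)
    (st : List DTree) : parseFrom (l.flatMap e) (x :: st) = l.foldr f x :: st := by
  induction l with
  | nil => rfl
  | cons a l ih => rw [List.flatMap_cons, parseFrom_append, ih, h]; rfl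

theorem parseFrom_seq {α : Type} (e : α → List Γ') (f : α → DTree → DTree)
    (h : ∀ a x st, parseFrom (e a) (x :: st) = f a x :: st) (l : List α) (x : DTree)
    (st : List DTree) :
    parseFrom (encodeSeq e l) (x :: st) = .node (l.foldr f .leaf) x :: st := by
  rw [encodeSeq, ← List.singleton_append, parseFrom_append, parseFrom_append]
  change parseFrom _ (parseFrom _ (.leaf :: x :: st)) = _
  rw [parseFrom_flatMap e f h]
  rfl

theorem foldr_node {α β : Type} [TreeEnc β] (f : α → β) (l : List α) :
    l.foldr (fun a x => DTree.node (enc (f a)) x) .leaf = enc (l.map f) := by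
  induction l with
  | nil => rfl
  | cons a l ih => simp [ih]

/-- Rows are not bracketed, so each adds four members to the list of the table: coordinates, signed
numerator, denominator, utilities. -/
theorem parseFrom_row (D : ExplicitInstance) (s : ∀ i, Fin (D.numValues i)) (x : DTree)
    (st : List DTree) : parseFrom (D.encodeRow s) (x :: st) =
      .node (D.rowLeft s).1 (.node (D.rowLeft s).2 (.node (D.rowRight s).1
        (.node (D.rowRight s).2 x))) :: st := by
  rw [encodeRow, parseFrom_append, parseFrom_append,
    parseFrom_seq _ _ (fun a => parseFrom_rational _), parseFrom_rational,
    parseFrom_seq _ _ (fun a => parseFrom_numeral _), foldr_node]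
  have : ∀ l : List ℚ, l.foldr (fun q x => DTree.node (enc (decide (q < 0), q.num.natAbs))
      (.node (enc q.den) x)) .leaf = enc (FlatRats.mk l) := by
    intro l
    induction l with
    | nil => rfl
    | cons q l ih => rw [List.foldr_cons, ih]; rfl
  have h := this (D.utils s)
  rw [utils, List.foldr_map] at h
  rw [h]
  rfl

theorem parseFrom_encode (D : ExplicitInstance) (x : DTree) :
    parseFrom D.encode [x] = [.node (enc D.numActions) (.node (enc ((List.finRange D.numCoords).map
      D.numValues)) (.node (enc D.flatTable) x))] := by
  rw [encode, parseFrom_append, parseFrom_append, parseFrom_seq _ _ (parseFrom_row D),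
    parseFrom_seq _ _ (fun a => parseFrom_numeral _), parseFrom_numeral, foldr_node]
  have : ∀ l : List (∀ i, Fin (D.numValues i)), l.foldr (fun s x => .node (D.rowLeft s).1
      (.node (D.rowLeft s).2 (.node (D.rowRight s).1 (.node (D.rowRight s).2 x)))) .leaf =
      enc ((l.flatMap fun s => [D.rowLeft s, D.rowRight s]).flatMap fun x => [x.1, x.2]) := by
    intro l
    induction l with
    | nil => rfl
    | cons s l ih => rw [List.foldr_cons, ih]; rfl
  rw [this]
  rfl

theorem polyTime_rows {σ : Type} [TreeEnc σ] {D : σ → ExplicitInstance}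
    (h : PolyTime fun x => (D x).flatTable) :
    PolyTime fun x => (D x).states.map (D x).row := by
  have h1 : PolyTime fun x => (D x).states.map fun s => ((((D x).coords s,
      decide ((D x).problem.prob s < 0), ((D x).problem.prob s).num.natAbs),
      ((D x).problem.prob s).den, FlatRats.mk ((D x).utils s)) :
      (List ℕ × Bool × ℕ) × ℕ × FlatRats) := by
    refine h.pairUp.pairUp.congr_enc fun x => ?_
    rw [flatTable, pairUp_flatMap, List.map_id', pairUp_flatMap]
    apply enc_map_congr
    exact fun s => rfl
  -- Grouping by pairs puts the numerator and the denominator of the probability into different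
  -- halves of the row; they are brought together here.
  have hq : PolyTime fun x : (List ℕ × Bool × ℕ) × ℕ × FlatRats => ((x.1.2, x.2.1), x.1.1, x.2.2) :=
    (PolyTime.fst'.snd.pair PolyTime.snd'.fst).pair (PolyTime.fst'.fst.pair PolyTime.snd'.snd)
  have h2 : PolyTime fun x => (D x).states.map fun s => (((D x).problem.prob s, (D x).coords s,
      FlatRats.mk ((D x).utils s)) : ℚ × List ℕ × FlatRats) := by
    refine (h1.map (f := fun _ y => ((y.1.2, y.2.1), y.1.1, y.2.2)) (hq.comp PolyTime.snd')).congr_enc fun x => ?_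
    rw [List.map_map]
    apply enc_map_congr
    exact fun s => rfl
  have h3 : PolyTime fun x : ℚ × List ℕ × FlatRats =>
      (x.2.1, Fraction.ofRat x.1, x.2.2.list.map Fraction.ofRat) :=
    PolyTime.snd'.fst.pair (PolyTime.fst'.ofRat.pair
      (PolyTime.snd'.snd.flatRats.map PolyTime.snd'.ofRat))
  exact (h2.map (f := fun _ x => (x.2.1, Fraction.ofRat x.1, x.2.2.list.map Fraction.ofRat))
    (h3.comp PolyTime.snd')).congr fun x => by rw [List.map_map]; rfl

/-- The parsed input with a budget. -/
theorem polyTime_budget :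
    PolyTime (fun x : WordInput encodeWithBudget => x.val.1.states.map x.val.1.row) ∧
      PolyTime (fun x : WordInput encodeWithBudget => x.val.2) := by
  have hp : ∀ x, parseFrom (encodeWithBudget x) [.leaf] = _ := fun x => by
    rw [encodeWithBudget, parseFrom_append, parseFrom_numeral, parseFrom_encode]
  have h := (PolyTime.parseFrom (e := encodeWithBudget)).headD (PolyTime.const DTree.leaf)
  have h' := PolyTime.treeSnd.comp (PolyTime.treeSnd.comp h)
  refine ⟨polyTime_rows ((PolyTime.treeFst.comp h').congr_enc fun x => ?_),
    (PolyTime.treeFst.comp (PolyTime.treeSnd.comp h')).congr_enc fun x => ?_⟩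
  · rw [hp]; rfl
  · rw [hp]; rfl

/-- The indicator sequence of a coordinate set. -/
def indicator (D : ExplicitInstance) (I : Finset (Fin D.numCoords)) : List Bool :=
  (List.finRange D.numCoords).map fun i => decide (i ∈ I)

/-- The parsed input with a coordinate set. -/
theorem polyTime_coords :
    PolyTime (fun x : WordInput encodeWithCoords => x.val.1.states.map x.val.1.row) ∧
      PolyTime (fun x : WordInput encodeWithCoords => x.val.1.indicator x.val.2) := by
  -- Without commas, the indicator bits gather in the first member of the bracketed list. If there
  -- are no bits, the list is a leaf, whose default left subtree is again the empty sequence.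
  have hs : ∀ l : List Bool, ∃ y, parseFrom (encodeSeq (fun b => [Γ'.bit b]) l) [.leaf] =
      [.node y .leaf] ∧ y.fst = enc l := by
    intro l
    have key : ∀ l : List Bool, ∃ y, parseFrom (l.flatMap fun b => [Γ'.bit b]) [.leaf, .leaf] =
        [y, .leaf] ∧ y.fst = enc l ∧ y.snd = .leaf := by
      intro l
      induction l with
      | nil => exact ⟨_, rfl, rfl, rfl⟩
      | cons b l ih =>
        obtain ⟨y, h1, h2, h3⟩ := ih
        refine ⟨.node (.node (enc b) y.fst) y.snd, ?_, by rw [h2]; rfl, h3⟩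
        rw [List.flatMap_cons, parseFrom_append, h1]
        rfl
    obtain ⟨y, h1, h2, -⟩ := key l
    refine ⟨y, ?_, h2⟩
    rw [encodeSeq, ← List.singleton_append, parseFrom_append, parseFrom_append]
    change parseFrom _ (parseFrom _ [.leaf, .leaf]) = _
    rw [h1]
    rfl
  have hp : ∀ x : (Σ D : ExplicitInstance, Finset (Fin D.numCoords)), ∃ y, parseFrom (encodeWithCoords x) [.leaf] =
      [.node (enc x.1.numActions) (.node (enc ((List.finRange x.1.numCoords).map x.1.numValues))
        (.node (enc x.1.flatTable) (.node y .leaf)))] ∧ y.fst = enc (x.1.indicator x.2) := by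
    intro x
    obtain ⟨y, h1, h2⟩ := hs (x.1.indicator x.2)
    refine ⟨y, ?_, h2⟩
    rw [encodeWithCoords, parseFrom_append, ← parseFrom_encode, ← h1]
    congr 2
    simp [encodeSeq, indicator, List.flatMap_map]
  have h := (PolyTime.parseFrom (e := encodeWithCoords)).headD (PolyTime.const DTree.leaf)
  have h' := PolyTime.treeSnd.comp (PolyTime.treeSnd.comp h)
  refine ⟨polyTime_rows ((PolyTime.treeFst.comp h').congr_enc fun x => ?_),
    (PolyTime.treeFst.comp (PolyTime.treeFst.comp (PolyTime.treeSnd.comp h'))).congr_enc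
      fun x => ?_⟩
  · obtain ⟨y, h1, -⟩ := hp x.val
    rw [h1]; rfl
  · obtain ⟨y, h1, h2⟩ := hp x.val
    rw [h1, ← h2]; rfl

end ExplicitInstance

/-! ## From polynomial-time functions to Turing machines -/

open TreeEnc Computability Turing

namespace StackProgram

open Cmd

/-- Move one of the listed symbols from the input to the list on the main stack. -/
def readSym : List Γ' → Cmd
  | [] => .skip
  | s :: l => .ite .inp (fun t => t == some s)
      (.seq (.pop .inp) (pushWord (true :: (enc s).code))) (readSym l)

theorem runs_readSym (s : Γ') (l : List Γ') (hs : s ∈ l) (i o m a b n) :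
    Runs (readSym l) (store (s :: i) o m a b n) (14 + l.length)
      (store i o (true :: ((enc s).code ++ m)) a b n) := by
  induction l with
  | nil => simp at hs
  | cons t l ih =>
    by_cases hst : s = t
    · subst hst
      refine (Runs.ite_true (by simp) ((runs_pop_inp ..).seq (runs_pushWord _ ..))).mono ?_
      rw [List.length_cons, List.length_cons, DTree.length_code]
      -- Three Booleans of at most three vertices each, and two pair nodes.
      have : (enc s).size ≤ 11 := by
        rcases s with _ | b | _ | _ | _
        on_goal 2 => cases b
        all_goals decide
      omega
    · refine (Runs.ite_false (by simpa using hst) (ih ?_)).mono (by rw [List.length_cons]; omega)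
      exact (List.mem_cons.1 hs).resolve_left hst

/-- The loop of `readInput`. -/
def readLoop : Cmd :=
  .loop .inp Option.isSome (readSym [.blank, .bit false, .bit true, .bra, .ket, .comma])

/-- Move the input, reversed, to the main stack. -/
def readInput : Cmd := .seq (.push .main false) readLoop

/-- Moving symbols from stack to stack reverses the word, which is why `WordInput` is encoded by the
reversed word. -/
theorem runs_readLoop (w : List Γ') : ∀ v : List Γ',
    Runs readLoop (store w [] (enc v).code [] [] []) (1 + 21 * w.length)
      (work (enc (w.reverse ++ v)).code [] []) := by
  induction w with
  | nil => exact fun v => Runs.loop_done rfl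
  | cons s w ih =>
    intro v
    have h := ih (s :: v)
    rw [show w.reverse ++ s :: v = (s :: w).reverse ++ v by simp] at h
    have h1 := runs_readSym s [.blank, .bit false, .bit true, .bra, .ket, .comma]
      (by rcases s with _ | b | _ | _ | _
          on_goal 2 => cases b
          all_goals simp) w [] (enc v).code [] [] []
    refine (Runs.loop_step rfl h1 h).mono ?_
    simp only [List.length_cons, List.length_nil]; omega

/-- Move a Boolean from the main stack to the output. -/
def writeOutput : Cmd :=
  .ite .main (fun s => s == some true)
    (.seq (.pop .main) (.seq (.pop .main) (.seq (.pop .main) (.push .out true))))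
    (.seq (.pop .main) (.push .out false))

theorem runs_writeOutput (x : Bool) :
    Runs writeOutput (work (enc x).code [] []) 5 (store [] [x] [] [] [] []) := by
  cases x
  · exact (Runs.ite_false rfl ((runs_pop_main ..).seq (runs_push_out ..))).mono (by omega)
  · exact (Runs.ite_true rfl ((runs_pop_main ..).seq ((runs_pop_main ..).seq
      ((runs_pop_main ..).seq (runs_push_out ..))))).mono (by omega)

/-- The machine that runs a program and halts. -/
def machine (c : Cmd) : FinTM2 where
  k₀ := .inp
  k₁ := .out
  Γ := Sym
  Λ := Option (Pos c)
  main := some (entry c)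
  σ := Bool
  initialState := false
  Γk₀Fin := inferInstanceAs (Fintype Γ')
  m
    | none => .load (fun _ => false) .halt
    | some q => code c some none q

/-- The extra step is the one at the exit label: it resets the register, as the halting
configuration demands, and halts. -/
theorem machine_outputs (c : Cmd) (w : List Γ') (x : Bool) (t : ℕ)
    (h : Runs c (store w [] [] [] [] []) t (store [] [x] [] [] [] [])) :
    Nonempty (TM2OutputsInTime (machine c) w (some [x]) (t + 1)) := by
  obtain ⟨u, hu, h⟩ := h
  obtain ⟨v, hv⟩ := h.steps_eq (machine c).m some none (fun _ => rfl) false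
  refine ⟨⟨⟨u + 1, ?_⟩, Nat.add_le_add_right hu 1⟩⟩
  have h0 : initList (machine c) w = ⟨some (some (entry c)), false, store w [] [] [] [] []⟩ := by
    unfold initList
    congr 1
    funext k
    cases k <;> rfl
  have h1 : haltList (machine c) [x] = ⟨none, false, store [] [x] [] [] [] []⟩ := by
    unfold haltList
    congr 1
    funext k
    cases k <;> rfl
  rw [h0, Option.map_some, h1]
  exact (steps_add (machine c).m u 1 _).trans ((congrArg _ hv).trans rfl)

end StackProgram

open StackProgram StackProgram.Cmd in
/-- A property decided by a polynomial-time function of the input word is decided by a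
polynomial-time Turing machine. -/
theorem PolyTime.polyTimeDecidable {α : Type} {e : α → List Γ'} {p : α → Prop} {f : α → Bool}
    (hf : PolyTime fun x : WordInput e => f x.val) (h : ∀ x, f x = true ↔ p x) :
    PolyTimeDecidable e p := by
  obtain ⟨c, q, hq⟩ := hf
  refine ⟨f, h, ⟨{
    tm := machine (.seq readInput (.seq c writeOutput))
    inputAlphabet := Equiv.refl _
    outputAlphabet := Equiv.refl _
    time := 8 + 21 * Polynomial.X + q.comp (1 + 12 * Polynomial.X)
    outputsFun := fun x => Classical.choice ?_ }⟩⟩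
  -- A symbol takes at most 11 vertices, and its list node one more.
  have hsize : treeSize (WordInput.mk x : WordInput e) ≤ 1 + 12 * (e x).length := by
    refine (treeSize_list_le (B := 11) (l := (e x).reverse) fun s _ => ?_).trans ?_
    · rcases s with _ | b | _ | _ | _
      on_goal 2 => cases b
      all_goals decide
    · rw [List.length_reverse]; omega
  have h1 := (hq ⟨x⟩).2 [] [] []
  rw [List.append_nil, List.append_nil] at h1
  have h2 := runs_readLoop (e x) []
  rw [List.append_nil] at h2
  have h3 := machine_outputs _ (e x) (f x) _
    (((runs_push_main ..).seq h2).seq (h1.seq (runs_writeOutput _)))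
  have h4 := q.eval_nat_mono hsize
  obtain ⟨h3⟩ := h3
  refine ⟨⟨⟨h3.steps, ?_⟩, h3.steps_le_m.trans ?_⟩⟩
  · have e1 : List.map (Equiv.refl Γ').invFun (e x) = e x := List.map_id _
    have e2 : List.map (Equiv.refl Bool).invFun (encodeBool (f x)) = [f x] := List.map_id _
    refine Eq.trans ?_ (h3.evals_in_steps.trans ?_)
    · exact congrArg (fun w => (flip bind _)^[h3.steps] (some (initList _ w))) e1
    · exact congrArg (fun w => Option.map _ (some w)) e2.symm
  · simp only [Polynomial.eval_add, Polynomial.eval_mul, Polynomial.eval_ofNat,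
      Polynomial.eval_X, Polynomial.eval_comp, Polynomial.eval_one]
    omega

/-! ## Correctness of the decision procedures -/

open TreeEnc Computability

theorem all_unaryIndices {α : Type} (l : List α) (t : List Unit → Bool) :
    (unaryIndices l).all t = true ↔ ∀ j < l.length, t (List.replicate j ()) = true := by
  simp [unaryIndices]

theorem getD_map_finRange {α : Type} {n : ℕ} (f : Fin n → α) (j : Fin n) (d : α) :
    ((List.finRange n).map f).getD j d = f j := by
  simp [List.getD]

theorem forall_lt_length_finRange {α : Type} {n : ℕ} (f : Fin n → α) (p : ℕ → Prop) :
    (∀ j < ((List.finRange n).map f).length, p j) ↔ ∀ j : Fin n, p j := by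
  rw [List.length_map, List.length_finRange]
  exact ⟨fun h j => h j j.2, fun h j hj => h ⟨j, hj⟩⟩

theorem Finset.restrict_eq_iff {ι : Type} {X : ι → Type} (I : Finset ι) (s t : ∀ i, X i) :
    I.restrict s = I.restrict t ↔ ∀ i ∈ I, s i = t i := by
  simp [funext_iff]

namespace StochasticDecisionProblem

variable {A : Type} {ι : Type} [Fintype ι] [DecidableEq ι] {X : ι → Type} [∀ i, Fintype (X i)]
  [∀ i, DecidableEq (X i)] (D : StochasticDecisionProblem A X)

/-- `∑ P(s) U(a, s)` over a fiber. -/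
def fiberUtil (I : Finset ι) (α : ∀ i : I, X i) (a : A) : ℚ :=
  ∑ s ∈ fiber I α, D.prob s * D.util a s

/-- Division by a positive probability preserves order. On a null fiber all probabilities vanish, so
both comparisons read 0 ≤ 0; hence the tie convention needs no case of its own. -/
theorem condUtil_le_iff (I : Finset ι) (α : ∀ i : I, X i) (a b : A) :
    D.condUtil I α b ≤ D.condUtil I α a ↔ D.fiberUtil I α b ≤ D.fiberUtil I α a := by
  rcases (Finset.sum_nonneg fun s _ => D.prob_nonneg s : 0 ≤ D.fiberProb I α).eq_or_lt with h | h
  · have h0 := (Finset.sum_eq_zero_iff_of_nonneg fun s _ => D.prob_nonneg s).1 h.symm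
    have h1 : ∀ a, D.fiberUtil I α a = 0 := fun a =>
      Finset.sum_eq_zero fun s hs => by rw [h0 s hs, zero_mul]
    have h2 : ∀ a, D.condUtil I α a = 0 := fun a => by
      rw [condUtil, show ∑ s ∈ fiber I α, D.prob s * D.util a s = 0 from h1 a, zero_div]
    rw [h1, h1, h2, h2]
  · exact div_le_div_iff_of_pos_right h

theorem condOpt_eq_opt_iff (I : Finset ι) (α : ∀ i : I, X i) (s : ∀ i, X i) :
    D.condOpt I α = D.opt s ↔ ∀ a, (∀ b, D.fiberUtil I α b ≤ D.fiberUtil I α a) ↔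
      ∀ b, D.util b s ≤ D.util a s := by
  simp [Set.ext_iff, condOpt, opt, condUtil_le_iff]

/-- Under every convention the set `I` enters only through the fiber of `s`. This permits discarding
coordinates with a single value. -/
theorem preservedAt_congr (c : NullFiberConvention) {I J : Finset ι} {s : ∀ i, X i}
    (h : ∀ t : ∀ i, X i, (∀ i ∈ I, t i = s i) ↔ ∀ i ∈ J, t i = s i) :
    D.PreservedAt c I s ↔ D.PreservedAt c J s := by
  have hF : fiber I (I.restrict s) = fiber J (J.restrict s) := by
    ext t
    simp only [fiber, Finset.mem_filter, Finset.mem_univ, true_and, Finset.restrict_eq_iff, h]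
  have hP : D.fiberProb I (I.restrict s) = D.fiberProb J (J.restrict s) := by
    rw [fiberProb, fiberProb, hF]
  have hC : D.condOpt I (I.restrict s) = D.condOpt J (J.restrict s) := by
    simp only [condOpt, condUtil, hP, hF]
  cases c <;> simp only [PreservedAt, hP, hC]

end StochasticDecisionProblem

theorem StochasticDecisionProblem.nonempty_state {A ι : Type} [Fintype ι] [DecidableEq ι]
    {X : ι → Type} [∀ i, Fintype (X i)] (D : StochasticDecisionProblem A X) :
    Nonempty (∀ i, X i) := by
  by_contra h
  rw [not_nonempty_iff] at h
  simpa using D.prob_sum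

/-! ### The procedures on tables answer the two questions -/

namespace ExplicitInstance

variable (D : ExplicitInstance)

theorem mem_states (s : ∀ i, Fin (D.numValues i)) : s ∈ D.states :=
  List.mem_map.2 ⟨finPiFinEquiv s, List.mem_finRange _, Equiv.symm_apply_apply _ _⟩

theorem sum_states (f : (∀ i, Fin (D.numValues i)) → ℚ) : (D.states.map f).sum = ∑ s, f s := by
  rw [states, List.map_map, ← Equiv.sum_comp finPiFinEquiv.symm f, Fin.sum_univ_def]
  rfl

theorem sum_filter_states (q : (∀ i, Fin (D.numValues i)) → Bool)
    (f : (∀ i, Fin (D.numValues i)) → ℚ) :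
    ((D.states.filter q).map f).sum = ∑ s with q s = true, f s := by
  rw [Finset.sum_filter, ← sum_states]
  induction D.states with
  | nil => rfl
  | cons s l ih => cases h : q s <;> simp [h, ih]

variable {D} (I : Finset (Fin D.numCoords)) (s t : ∀ i, Fin (D.numValues i))

theorem agree_iff : TableRow.agree (D.indicator I) (D.coords s) (D.coords t) = true ↔
    ∀ i ∈ I, s i = t i := by
  rw [TableRow.agree, all_unaryIndices, indicator, forall_lt_length_finRange]
  refine forall_congr' fun i => ?_
  rw [List.length_replicate, coords, coords, getD_map_finRange, getD_map_finRange,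
    getD_map_finRange]
  by_cases h : i ∈ I <;> simp [h, Fin.ext_iff]

theorem fiber_rows : TableRow.fiber (D.indicator I) (D.states.map D.row) (D.row s) =
    (D.states.filter fun t => TableRow.agree (D.indicator I) (D.coords t) (D.coords s)).map
      D.row := by
  rw [TableRow.fiber, List.filter_map]
  rfl

theorem fiber_eq : (Finset.univ.filter fun t : ∀ i, Fin (D.numValues i) =>
    TableRow.agree (D.indicator I) (D.coords t) (D.coords s) = true) =
      StochasticDecisionProblem.fiber I (I.restrict s) := by
  ext t
  simp only [StochasticDecisionProblem.fiber, Finset.mem_filter, Finset.mem_univ, true_and,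
    agree_iff, Finset.restrict_eq_iff]

theorem positive_iff :
    TableRow.positive (TableRow.fiber (D.indicator I) (D.states.map D.row) (D.row s)) = true ↔
      0 < D.problem.fiberProb I (I.restrict s) := by
  rw [fiber_rows, TableRow.positive, List.map_map]
  obtain ⟨h1, h2⟩ := Fraction.sum_spec ((D.states.filter fun t =>
    TableRow.agree (D.indicator I) (D.coords t) (D.coords s)).map
      ((fun r : TableRow => r.2.1) ∘ D.row)) (by
        simp only [List.mem_map, forall_exists_index, and_imp]
        rintro _ t _ rfl
        exact Fraction.den_ofRat _)
  rw [List.map_map, show Fraction.val ∘ (fun r : TableRow => r.2.1) ∘ D.row = D.problem.prob from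
    funext fun t => Fraction.val_ofRat _, sum_filter_states, fiber_eq] at h2
  rw [Bool.not_eq_true', ← Bool.not_eq_true, Fraction.le_eq_true_iff h1 Nat.one_pos, h2,
    Fraction.val_zero, not_le]
  rfl

/-- Positivity of the denominator accompanies the value because cross-multiplied comparison of
fractions relies on it. -/
theorem weight_spec (a : Fin D.numActions) :
    0 < (TableRow.weight (TableRow.fiber (D.indicator I) (D.states.map D.row) (D.row s))
        (List.replicate a ())).2.2 ∧
      (TableRow.weight (TableRow.fiber (D.indicator I) (D.states.map D.row) (D.row s))
        (List.replicate a ())).val = D.problem.fiberUtil I (I.restrict s) a := by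
  have hu : ∀ t, (D.row t).2.2.getD a Fraction.zero = Fraction.ofRat (D.problem.util a t) := by
    intro t
    rw [row, utils, List.map_map]
    exact getD_map_finRange _ a _
  rw [fiber_rows, TableRow.weight, List.map_map, List.length_replicate]
  obtain ⟨h1, h2⟩ := Fraction.sum_spec ((D.states.filter fun t =>
    TableRow.agree (D.indicator I) (D.coords t) (D.coords s)).map
      ((fun r : TableRow => Fraction.mul r.2.1 (r.2.2.getD a Fraction.zero)) ∘ D.row)) (by
        simp only [List.mem_map, forall_exists_index, and_imp]
        rintro _ t _ rfl
        simp only [Function.comp_apply, hu]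
        exact Nat.mul_pos (Fraction.den_ofRat _) (Fraction.den_ofRat _))
  refine ⟨h1, h2.trans ?_⟩
  rw [List.map_map, show Fraction.val ∘ (fun r : TableRow => Fraction.mul r.2.1
    (r.2.2.getD a Fraction.zero)) ∘ D.row = fun t => D.problem.prob t * D.problem.util a t from
    funext fun t => by
      simp only [Function.comp_apply, hu, Fraction.val_mul, Fraction.val_ofRat]
      exact congrArg (· * _) (Fraction.val_ofRat _), sum_filter_states, fiber_eq]
  rfl

theorem sameOpt_iff :
    TableRow.sameOpt (TableRow.fiber (D.indicator I) (D.states.map D.row) (D.row s)) (D.row s) =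
      true ↔ D.problem.condOpt I (I.restrict s) = D.problem.opt s := by
  rw [StochasticDecisionProblem.condOpt_eq_opt_iff, TableRow.sameOpt, all_unaryIndices]
  have hr : (D.row s).2.2 = (List.finRange D.numActions).map fun a =>
      Fraction.ofRat (D.problem.util a s) := by
    rw [row, utils, List.map_map]; rfl
  rw [hr, forall_lt_length_finRange]
  refine forall_congr' fun a => ?_
  rw [beq_iff_eq, Bool.eq_iff_iff, all_unaryIndices, all_unaryIndices, forall_lt_length_finRange,
    forall_lt_length_finRange]
  refine iff_congr (forall_congr' fun b => ?_) (forall_congr' fun b => ?_)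
  · rw [Fraction.le_eq_true_iff (weight_spec I s b).1 (weight_spec I s a).1,
      (weight_spec I s b).2, (weight_spec I s a).2]
  · rw [List.length_replicate, List.length_replicate, getD_map_finRange, getD_map_finRange,
      Fraction.le_eq_true_iff (Fraction.den_ofRat _) (Fraction.den_ofRat _), Fraction.val_ofRat,
      Fraction.val_ofRat]

theorem preserved_iff (c : NullFiberConvention) :
    TableRow.preserved c (D.indicator I) (D.states.map D.row) (D.row s) = true ↔
      D.problem.PreservedAt c I s := by
  cases c with
  | exempt =>
    rw [TableRow.preserved, StochasticDecisionProblem.PreservedAt, ← positive_iff, ← sameOpt_iff]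
    cases TableRow.positive _ <;> simp
  | strict =>
    rw [TableRow.preserved, StochasticDecisionProblem.PreservedAt, ← positive_iff, ← sameOpt_iff,
      Bool.and_eq_true]
  | tie => exact sameOpt_iff I s

/-- The nonzero coordinates of a state. -/
def nonzero : Finset (Fin D.numCoords) := Finset.univ.filter fun i => (s i : ℕ) ≠ 0

theorem support_row : (D.row s).support = D.indicator (nonzero s) := by
  rw [TableRow.support, row, coords, List.map_map, indicator]
  congr 1
  funext i
  simp [nonzero]

theorem length_filter_indicator : ((D.indicator I).filter id).length = I.card := by
  rw [indicator, List.filter_map, List.length_map,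
    ← List.toFinset_card_of_nodup ((List.nodup_finRange _).filter _)]
  congr 1
  ext i
  simp

/-- Any sufficient set can be shrunk to its coordinates with at least two values without changing a
fiber, and what remains is the set of nonzero coordinates of some state. Hence the search over rows
misses nothing. -/
theorem minimum_iff (c : NullFiberConvention) (k : ℕ) :
    TableRow.minimum c (D.states.map D.row) k = true ↔ D.problem.MinimumPreservation c k := by
  have h : TableRow.minimum c (D.states.map D.row) k = true ↔
      ∃ t, (nonzero t).card ≤ k ∧ D.problem.StochasticallySufficient c (nonzero t) := by
    simp only [TableRow.minimum, List.any_eq_true, List.all_eq_true, List.mem_map,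
      exists_exists_and_eq_and, forall_exists_index, and_imp, forall_apply_eq_imp_iff₂,
      Bool.and_eq_true, decide_eq_true_eq, support_row, length_filter_indicator, preserved_iff]
    exact ⟨fun ⟨t, _, h1, h2⟩ => ⟨t, h1, fun s => h2 s (mem_states D s)⟩,
      fun ⟨t, h1, h2⟩ => ⟨t, mem_states D t, h1, fun s _ => h2 s⟩⟩
  rw [h]
  refine ⟨fun ⟨t, h1, h2⟩ => ⟨_, h1, h2⟩, fun ⟨I, h1, h2⟩ => ?_⟩
  obtain ⟨s₀⟩ := D.problem.nonempty_state
  let t : ∀ i, Fin (D.numValues i) := fun i =>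
    if h : i ∈ I ∧ 1 < D.numValues i then ⟨1, h.2⟩ else ⟨0, (Nat.zero_le _).trans_lt (s₀ i).2⟩
  have ht : ∀ i, i ∈ nonzero t ↔ i ∈ I ∧ 1 < D.numValues i := by
    intro i
    by_cases h : i ∈ I ∧ 1 < D.numValues i <;> simp [nonzero, t, h]
  refine ⟨t, (Finset.card_le_card fun i hi => ((ht i).1 hi).1).trans h1, fun s => ?_⟩
  refine (D.problem.preservedAt_congr c fun u => ⟨fun h i hi => ?_, fun h i hi =>
    h i ((ht i).1 hi).1⟩).2 (h2 s)
  by_cases h3 : 1 < D.numValues i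
  · exact h i ((ht i).2 ⟨hi, h3⟩)
  · have := (u i).2
    have := (s i).2
    exact Fin.ext (by omega)

theorem anchor_iff (c : NullFiberConvention) :
    TableRow.anchor c (D.states.map D.row) (D.indicator I) = true ↔
      D.problem.AnchorPreservation c I := by
  simp only [TableRow.anchor, List.any_eq_true, List.all_eq_true, List.mem_map,
    exists_exists_and_eq_and, forall_exists_index, and_imp, forall_apply_eq_imp_iff₂,
    Bool.or_eq_true, Bool.not_eq_true', ← Bool.not_eq_true, preserved_iff]
  have h : ∀ s t, TableRow.agree (D.indicator I) (D.row s).1 (D.row t).1 = true ↔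
    ∀ i ∈ I, s i = t i := agree_iff I
  simp only [h, ← imp_iff_not_or]
  exact ⟨fun ⟨t, _, h1⟩ => ⟨t, fun s => h1 s (mem_states D s)⟩,
    fun ⟨t, h1⟩ => ⟨t, mem_states D t, fun s _ => h1 s⟩⟩

end ExplicitInstance

theorem mainTheorem8 (c : NullFiberConvention) :
    PolyTimeDecidable ExplicitInstance.encodeWithBudget
        (fun x : ExplicitInstance × ℕ => x.1.problem.MinimumPreservation c x.2) ∧
      PolyTimeDecidable ExplicitInstance.encodeWithCoords
        (fun x : Σ D : ExplicitInstance, Finset (Fin D.numCoords) =>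
          x.1.problem.AnchorPreservation c x.2) := by
  constructor
  · exact PolyTime.polyTimeDecidable
      (f := fun x => TableRow.minimum c (x.1.states.map x.1.row) x.2)
      (ExplicitInstance.polyTime_budget.1.minimum c ExplicitInstance.polyTime_budget.2)
      fun x => ExplicitInstance.minimum_iff c x.2
  · exact PolyTime.polyTimeDecidable
      (f := fun x => TableRow.anchor c (x.1.states.map x.1.row) (x.1.indicator x.2))
      (ExplicitInstance.polyTime_coords.1.anchor c ExplicitInstance.polyTime_coords.2)
      fun x => ExplicitInstance.anchor_iff x.2 c
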